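/- **Abhyankar–Jung Theorem.** Let $K$ be an algebraically closed field of characteristic zero, let $x=(x_1,\dots,x_n)$, and let $P(y)\in K[[x]][y]$ be a monic polynomial of degree $d$ in $y$ whose discriminant has the form $\Delta_P=x^{\alpha}u(x)$ with $\alpha\in\mathbb{N}^n$, $u\in K[[x]]$ and $u(0)\neq 0$. For $N\ge 1$ let $K[[x^{1/N}]]=K[[x_1^{1/N},\dots,x_n^{1/N}]]\supseteq K[[x]]$ be the ring of formal series $\sum_{a\in\frac1N\mathbb{N}^n}c_a x^a$ with $c_a\in K$. Then the roots of $P$ lie in $K[[x^{1/d!}]]$: there are $\xi_1,\dots,\xi_d\in K[[x^{1/d!}]]$ with $$P(y)=\prod_{i=1}^d (y-\xi_i),$$ and consequently, if $L$ is an integral domain and $K[[x^{1/d!}]]\to L$ is a ring homomorphism (for example the inclusion into an algebraic closure of the fraction field of $K[[x^{1/d!}]]$), then every root of $P$ in $L$ is the image of a root of $P$ in $K[[x^{1/d!}]]$. -/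

import Mathlib

/-- Formal series in `x₁, …, xₙ` over `K` with rational exponents, with support partially
well-ordered for the coordinatewise order (so that the product is defined). This ambient ring
contains `K⟦x^{1/N}⟧` for every `N ≥ 1`. -/
abbrev FracSeries (n : ℕ) (K : Type*) [Field K] : Type _ := HahnSeries (Fin n →₀ ℚ) K

/-- The exponent inclusion `ℕⁿ → ℚⁿ`. -/
noncomputable def natExponent (n : ℕ) : (Fin n →₀ ℕ) →+ (Fin n →₀ ℚ) :=
  Finsupp.mapRange.addMonoidHom (Nat.castAddMonoidHom ℚ)

theorem natExponent_apply {n : ℕ} (a : Fin n →₀ ℕ) (i : Fin n) :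
    natExponent n a i = (a i : ℚ) := by
  simp [natExponent]

theorem natExponent_injective (n : ℕ) : Function.Injective (natExponent n) := by
  intro a b h
  ext i
  have := DFunLike.congr_fun h i
  simpa [natExponent_apply] using this

theorem natExponent_le {n : ℕ} (a b : Fin n →₀ ℕ) :
    natExponent n a ≤ natExponent n b ↔ a ≤ b := by
  simp [Finsupp.le_def, natExponent_apply]

/-- The inclusion of `K⟦x₁, …, xₙ⟧` in the series with rational exponents:
`∑ cₐ xᵃ ↦ ∑ cₐ xᵃ`. -/
noncomputable def powerSeriesToFracSeries (n : ℕ) (K : Type*) [Field K] :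
    MvPowerSeries (Fin n) K →+* FracSeries n K :=
  (HahnSeries.embDomainRingHom (natExponent n) (natExponent_injective n) natExponent_le).comp
    (HahnSeries.toMvPowerSeries (σ := Fin n) (R := K)).symm.toRingHom

/-- The ring `K⟦x^{1/N}⟧ = K⟦x₁^{1/N}, …, xₙ^{1/N}⟧` (for `N ≥ 1`): the series all of whose
exponents `a` lie in `(1/N) ℕⁿ`, that is, `N a ∈ ℕⁿ`. -/
noncomputable def rootPowerSeries (n : ℕ) (K : Type*) [Field K] (N : ℕ) :
    Subring (FracSeries n K) where
  carrier := {f | ∀ a ∈ f.support, ∃ b : Fin n →₀ ℕ, N • a = natExponent n b}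
  mul_mem' := by
    intro f g hf hg a ha
    obtain ⟨u, hu, v, hv, rfl⟩ := HahnSeries.support_mul_subset ha
    obtain ⟨b, hb⟩ := hf u hu
    obtain ⟨c, hc⟩ := hg v hv
    exact ⟨b + c, by simp only [smul_add, map_add, hb, hc]⟩
  one_mem' := by
    intro a ha
    have h : a = 0 := by
      by_contra h
      simp [h] at ha
    exact ⟨0, by simp [h]⟩
  add_mem' := by
    intro f g hf hg a ha
    rcases HahnSeries.support_add_subset _ _ ha with h | h
    · exact hf a h
    · exact hg a h
  zero_mem' := by
    intro a ha
    simp at ha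
  neg_mem' := by
    intro f hf a ha
    exact hf a (by simpa using ha)

theorem powerSeriesToFracSeries_mem {n : ℕ} {K : Type*} [Field K] (N : ℕ)
    (f : MvPowerSeries (Fin n) K) :
    powerSeriesToFracSeries n K f ∈ rootPowerSeries n K N := by
  intro a ha
  have h : a ∈ Set.range (natExponent n) := by
    by_contra h
    exact ha (HahnSeries.embDomain_of_notMem_range h)
  obtain ⟨b, rfl⟩ := h
  exact ⟨N • b, by simp⟩

/-- The inclusion `K⟦x⟧ ⊆ K⟦x^{1/N}⟧`. -/
noncomputable def powerSeriesToRoot (n : ℕ) (K : Type*) [Field K] (N : ℕ) :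
    MvPowerSeries (Fin n) K →+* rootPowerSeries n K N :=
  (powerSeriesToFracSeries n K).codRestrict (rootPowerSeries n K N)
    (powerSeriesToFracSeries_mem N)

/-! The discriminant vanishes only on the coordinate hyperplanes, so the roots can ramify only
there. The ramification along each hyperplane is removed by `x ↦ x^{d!}`; a solution of an étale
equation that stays bounded at the hyperplanes is then a power series.

Write `R = K⟦x⟧`. The place `placeHom K i : R → V = k⟦t⟧`, `xᵢ ↦ xᵢ t`, with `k` an algebraic
closure of `Frac R`, sees the divisor `xᵢ = 0`. By Newton–Puiseux with index `d!`
(`PowerSeries.splits_map_expand_factorial`) the ramified polynomial, again called `P`, splits over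
`V` at every place.

A root in `R` is then found as follows (`exists_isRoot_of_splits_placeHom`). Since `P' p + P q` is a
monomial `m`, the algebra `E = (R[y]/P)[1/m]` is étale and the `∂/∂xₗ` extend to commuting
derivations of it. Let `B ⊆ E` consist of the elements with values in `V` at all places. It contains
`y`, is stable under the derivations, and is integral over `R`
(`StandardEtalePair.isIntegral_of_forall_mem_range`). By integrality the evaluation `R → K` at the
origin extends to `χ : B → K`. Taylor expansion `b ↦ ∑ χ(∂ᵃ b)/a! xᵃ` is a ring homomorphism `B → R`
which is the identity on `R`, so it sends `y` to a root of `P`. The relation giving `m` passes to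
the cofactor of a root, and induction on the degree splits `P`. -/

/-! ### Factorization over complete local rings and scaling of roots -/

/-- Weierstrass preparation, applied to `Q` as a power series in the variable, does the work of
Hensel's lemma: the distinguished factor collects the roots that reduce to `0`. -/
theorem Polynomial.exists_monic_factor_of_isUnit_coeff {A : Type*} [CommRing A] [IsLocalRing A]
    [IsAdicComplete (IsLocalRing.maximalIdeal A) A] {Q : Polynomial A} (hQ : Q.Monic) {e : ℕ}
    (he : IsUnit (Q.coeff e)) (hlt : ∀ i < e, ¬ IsUnit (Q.coeff i)) :
    ∃ f g : Polynomial A, f.Monic ∧ g.Monic ∧ f.natDegree = e ∧ Q = f * g := by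
  have horder : ((Q : PowerSeries A).map (IsLocalRing.residue A)).order = e := by
    rw [PowerSeries.order_eq_nat]
    refine ⟨?_, fun i hi => ?_⟩
    · rw [PowerSeries.coeff_map, Polynomial.coeff_coe]
      exact fun h => (IsLocalRing.residue_eq_zero_iff _).1 h he
    · rw [PowerSeries.coeff_map, Polynomial.coeff_coe, IsLocalRing.residue_eq_zero_iff]
      exact hlt i hi
  have hne : (Q : PowerSeries A).map (IsLocalRing.residue A) ≠ 0 := by
    intro h
    rw [h, PowerSeries.order_zero] at horder
    exact ENat.top_ne_natCast _ horder
  obtain ⟨f, h, H⟩ := PowerSeries.exists_isWeierstrassFactorization hne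
  have hf : f.Monic := H.isDistinguishedAt.monic
  have hdeg : f.natDegree = e := by
    rw [H.natDegree_eq_toNat_order_map, horder, ENat.toNat_natCast]
  have hI : IsLocalRing.maximalIdeal A ≠ ⊤ := Ideal.IsMaximal.ne_top inferInstance
  have hforder := H.isDistinguishedAt.coe_natDegree_eq_order_map (f : PowerSeries A) 1
    (by rwa [PowerSeries.constantCoeff_one, ← Ideal.ne_top_iff_one]) (by simp)
  -- The series `f * (h - Q /ₘ f)` equals the remainder `Q %ₘ f`, of degree less than that of `f`;
  -- uniqueness in Weierstrass division makes both vanish.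
  have hr := (H.isDistinguishedAt.isWeierstrassDivisorAt hI).eq_zero_of_mul_eq
    (q := h - (Q /ₘ f : Polynomial A)) (r := Q %ₘ f) (by
      rw [← hforder, ENat.toNat_natCast, ← Polynomial.degree_eq_natDegree hf.ne_zero]
      exact Polynomial.degree_modByMonic_lt _ hf) (by
      have := congrArg (fun p : Polynomial A => (p : PowerSeries A))
        (Polynomial.modByMonic_add_div Q f)
      simp only [Polynomial.coe_add, Polynomial.coe_mul] at this
      rw [mul_sub, ← H.eq_mul, ← this]
      ring)
  have hmul : Q = f * (Q /ₘ f) := by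
    have := Polynomial.modByMonic_add_div Q f
    rw [hr.2, zero_add] at this
    exact this.symm
  exact ⟨f, Q /ₘ f, hf, hf.of_mul_monic_left (hmul ▸ hQ), hdeg, hmul⟩

/-- Divides all roots by `s`. It serves for the Newton polygon and, later, for clearing denominators
in the integrality argument. -/
theorem Polynomial.exists_scaleRoots_eq {A : Type*} [CommRing A] {p : Polynomial A}
    (hp : p.Monic) (s : A) (h : ∀ i ≤ p.natDegree, s ^ (p.natDegree - i) ∣ p.coeff i) :
    ∃ q : Polynomial A, q.Monic ∧ q.natDegree = p.natDegree ∧ q.scaleRoots s = p := by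
  nontriviality A
  choose! b hb using h
  set d := p.natDegree with hd
  let q : Polynomial A := X ^ d + ∑ i ∈ Finset.range d, C (b i) * X ^ i
  have hdeg : (∑ i ∈ Finset.range d, C (b i) * X ^ i : Polynomial A).degree < d := by
    refine Polynomial.mem_degreeLT.1 (Submodule.sum_mem _ fun i hi => Polynomial.mem_degreeLT.2 ?_)
    exact (Polynomial.degree_C_mul_X_pow_le _ _).trans_lt
      (by exact_mod_cast Finset.mem_range.1 hi)
  have hmon : q.Monic := Polynomial.monic_X_pow_add hdeg
  have hnat : q.natDegree = d := by
    refine Polynomial.natDegree_eq_of_degree_eq_some ?_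
    rw [Polynomial.degree_add_eq_left_of_degree_lt (by simpa using hdeg), Polynomial.degree_X_pow]
  refine ⟨q, hmon, hnat, ?_⟩
  ext i
  rw [Polynomial.coeff_scaleRoots, hnat]
  rcases lt_trichotomy i d with hi | hi | hi
  · rw [hb i hi.le, mul_comm]
    congr 1
    simp [q, Polynomial.coeff_X_pow, hi.ne, hi]
  · subst hi
    rw [← hnat, hmon.coeff_natDegree, Nat.sub_self, hnat, hd, hp.coeff_natDegree]
    simp
  · rw [Polynomial.coeff_eq_zero_of_natDegree_lt (p := q) (by omega), zero_mul,
      Polynomial.coeff_eq_zero_of_natDegree_lt (p := p) (by omega)]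

instance PowerSeries.isAdicComplete_maximalIdeal (k : Type*) [Field k] :
    IsAdicComplete (IsLocalRing.maximalIdeal (PowerSeries k)) (PowerSeries k) := by
  rw [PowerSeries.maximalIdeal_eq_span_X]
  infer_instance

theorem Polynomial.coeff_taylor_of_natDegree_eq_succ {A : Type*} [CommRing A] {P : Polynomial A}
    (c : A) {d : ℕ} (h : P.natDegree = d + 1) :
    (P.taylor c).coeff d = P.coeff d + (d + 1 : ℕ) * P.coeff (d + 1) * c := by
  rw [Polynomial.taylor_coeff, Polynomial.eval_eq_sum_range' (n := 2)]
  · simp [Finset.sum_range_succ, Polynomial.hasseDeriv_coeff, add_comm 1 d,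
      Nat.choose_succ_self_right]
  · have := Polynomial.natDegree_hasseDeriv_le P d
    omega

/-! ### Newton–Puiseux in one variable -/

section NewtonPuiseux

variable {k : Type*} [Field k]

theorem Polynomial.Splits.of_taylor {A : Type*} [CommRing A] {P : Polynomial A} (c : A)
    (h : (P.taylor c).Splits) : P.Splits := by
  have := h.taylor (-c)
  rwa [Polynomial.taylor_taylor, neg_add_cancel, Polynomial.taylor_zero] at this

/-- The substitution `t ↦ tᴺ` as a ring homomorphism. -/
noncomputable def PowerSeries.expandHom (k : Type*) [Field k] (N : ℕ) (hN : N ≠ 0) :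
    PowerSeries k →+* PowerSeries k :=
  (PowerSeries.expand N hN).toRingHom

theorem PowerSeries.expandHom_apply {N : ℕ} (hN : N ≠ 0) (f : PowerSeries k) :
    PowerSeries.expandHom k N hN f = PowerSeries.expand N hN f := rfl

theorem PowerSeries.expandHom_injective {N : ℕ} (hN : N ≠ 0) :
    Function.Injective (PowerSeries.expandHom k N hN) := by
  intro f g h
  ext m
  have := congrArg (PowerSeries.coeff (N * m)) h
  simpa [PowerSeries.expandHom_apply] using this

theorem PowerSeries.expandHom_comp {M N : ℕ} (hM : M ≠ 0) (hN : N ≠ 0) :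
    (PowerSeries.expandHom k N hN).comp (PowerSeries.expandHom k M hM) =
      PowerSeries.expandHom k (N * M) (mul_ne_zero hN hM) := by
  ext1 f
  simp [PowerSeries.expandHom_apply, PowerSeries.expand_mul N hN M hM]

/-- A monic polynomial over `k⟦t⟧` whose residue polynomial is not a power of a linear factor is a
product of two monic polynomials of smaller degree. -/
theorem PowerSeries.exists_monic_factor [IsAlgClosed k] {Q : Polynomial (PowerSeries k)}
    (hQ : Q.Monic) (hd : Q.natDegree ≠ 0)
    (hpow : ∀ c : k, Q.map (PowerSeries.constantCoeff (R := k)) ≠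
      (Polynomial.X - Polynomial.C c) ^ Q.natDegree) :
    ∃ (c : PowerSeries k) (f g : Polynomial (PowerSeries k)), f.Monic ∧ g.Monic ∧
      f.natDegree < Q.natDegree ∧ g.natDegree < Q.natDegree ∧ Q.taylor c = f * g := by
  set q := Q.map (PowerSeries.constantCoeff (R := k)) with hq
  have hqm : q.Monic := hQ.map _
  have hqd : q.natDegree = Q.natDegree := hQ.natDegree_map _
  obtain ⟨c, hc⟩ := IsAlgClosed.exists_root q
    (by rw [Polynomial.degree_eq_natDegree hqm.ne_zero, hqd]; exact_mod_cast hd)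
  have htq : (Q.taylor (PowerSeries.C c)).map (PowerSeries.constantCoeff (R := k)) =
      q.taylor c := by
    simp [hq, Polynomial.taylor_apply, Polynomial.map_comp]
  have hTm : (Q.taylor (PowerSeries.C c)).Monic := by
    rw [Polynomial.taylor_apply]; exact hQ.comp_X_add_C _
  have hTd : (Q.taylor (PowerSeries.C c)).natDegree = Q.natDegree :=
    Polynomial.natDegree_taylor _ _
  have hqTm : (q.taylor c).Monic := htq ▸ hTm.map _
  have hqTd : (q.taylor c).natDegree = Q.natDegree := by
    rw [Polynomial.natDegree_taylor, hqd]
  have hunit : ∀ i, IsUnit ((Q.taylor (PowerSeries.C c)).coeff i) ↔ (q.taylor c).coeff i ≠ 0 := by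
    intro i
    rw [← htq, Polynomial.coeff_map, PowerSeries.isUnit_iff_constantCoeff, isUnit_iff_ne_zero]
  -- The multiplicity of the root `c` of the residue polynomial: positive because `c` is a root,
  -- less than the degree by `hpow`.
  set e := (q.taylor c).natTrailingDegree with he
  have hne : q.taylor c ≠ 0 := hqTm.ne_zero
  obtain ⟨f, g, hf, hg, hfd, hfg⟩ := Polynomial.exists_monic_factor_of_isUnit_coeff hTm (e := e)
    ((hunit e).2 (by
      have := Polynomial.trailingCoeff_nonzero_iff_nonzero.2 hne
      rwa [Polynomial.trailingCoeff] at this))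
    (fun i hi h => (hunit i).1 h (Polynomial.coeff_eq_zero_of_lt_natTrailingDegree hi))
  have hsum : f.natDegree + g.natDegree = Q.natDegree := by
    rw [← hf.natDegree_mul hg, ← hfg, hTd]
  have he0 : e ≠ 0 := by
    intro h
    have h0 : (q.taylor c).coeff 0 = 0 := by rw [Polynomial.taylor_coeff_zero]; exact hc
    have := Polynomial.trailingCoeff_nonzero_iff_nonzero.2 hne
    rw [Polynomial.trailingCoeff, ← he, h] at this
    exact this h0
  have hed : e ≠ Q.natDegree := by
    intro h
    have hX : q.taylor c = Polynomial.X ^ Q.natDegree := by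
      ext i
      rw [Polynomial.coeff_X_pow]
      split_ifs with hi
      · rw [hi, ← hqTd, hqTm.coeff_natDegree]
      · rcases lt_or_gt_of_ne hi with hi | hi
        · exact Polynomial.coeff_eq_zero_of_lt_natTrailingDegree (by omega)
        · exact Polynomial.coeff_eq_zero_of_natDegree_lt (by omega)
    refine hpow c ?_
    have := congrArg (Polynomial.taylor (-c)) hX
    rw [Polynomial.taylor_taylor, neg_add_cancel, Polynomial.taylor_zero] at this
    rw [this]
    simp [Polynomial.taylor_apply, sub_eq_add_neg]
  exact ⟨PowerSeries.C c, f, g, hf, hg, by omega, by omega, hfg⟩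

/-- The Newton polygon step: a depressed polynomial becomes, after a ramification and a scaling of
the roots, a polynomial whose residue has two distinct roots. -/
theorem PowerSeries.exists_scaleRoots_of_depressed [CharZero k] {P : Polynomial (PowerSeries k)}
    (hP : P.Monic) {d : ℕ} (hd : P.natDegree = d + 1) (hdep : P.coeff d = 0)
    (hne : P ≠ Polynomial.X ^ (d + 1)) :
    ∃ (s : PowerSeries k) (Q : Polynomial (PowerSeries k)), Q.Monic ∧ Q.natDegree = d + 1 ∧
      Q.scaleRoots s = P.map (PowerSeries.expandHom k _ (d + 1).factorial_ne_zero) ∧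
      ∀ c : k, Q.map (PowerSeries.constantCoeff (R := k)) ≠
        (Polynomial.X - Polynomial.C c) ^ (d + 1) := by
  classical
  set N := (d + 1).factorial with hN
  set S := (Finset.range (d + 1)).filter fun i => P.coeff i ≠ 0 with hS
  have hSne : S.Nonempty := by
    by_contra h
    rw [Finset.not_nonempty_iff_eq_empty] at h
    refine hne ?_
    ext1 i
    rw [Polynomial.coeff_X_pow]
    split_ifs with hi
    · rw [hi, ← hd, hP.coeff_natDegree]
    · rcases lt_or_gt_of_ne hi with hi | hi
      · by_contra h0
        have : i ∈ S := Finset.mem_filter.2 ⟨Finset.mem_range.2 hi, h0⟩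
        simp [h] at this
      · exact Polynomial.coeff_eq_zero_of_natDegree_lt (by omega)
  set o : ℕ → ℕ := fun i => (P.coeff i).order.toNat with ho
  -- The minimum is a slope of the Newton polygon. Its denominator divides `d + 1 - i₀`, hence `(d +
  -- 1)!`, so after the ramification the slope is an integer `r`.
  obtain ⟨i₀, hi₀S, hmin⟩ := Finset.exists_min_image S
    (fun i => (o i : ℚ) / ((d + 1 - i : ℕ) : ℚ)) hSne
  obtain ⟨hi₀, hci₀⟩ := Finset.mem_filter.1 hi₀S
  rw [Finset.mem_range] at hi₀
  obtain ⟨w, hw⟩ : (d + 1 - i₀) ∣ N := Nat.dvd_factorial (by omega) (by omega)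
  set r := w * o i₀ with hr
  have hrN : r * (d + 1 - i₀) = N * o i₀ := by rw [hr, hw]; ring
  have hle : ∀ i ∈ S, r * (d + 1 - i) ≤ N * o i := by
    intro i hi
    have h1 := hmin i hi
    have hi' : i < d + 1 := Finset.mem_range.1 (Finset.mem_filter.1 hi).1
    have hp0 : (0 : ℚ) < ((d + 1 - i₀ : ℕ) : ℚ) := by exact_mod_cast (by omega : 0 < d + 1 - i₀)
    have hp1 : (0 : ℚ) < ((d + 1 - i : ℕ) : ℚ) := by exact_mod_cast (by omega : 0 < d + 1 - i)
    rw [div_le_div_iff₀ hp0 hp1] at h1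
    have h2 : o i₀ * (d + 1 - i) ≤ o i * (d + 1 - i₀) := by exact_mod_cast h1
    calc r * (d + 1 - i) = w * (o i₀ * (d + 1 - i)) := by rw [hr]; ring
      _ ≤ w * (o i * (d + 1 - i₀)) := Nat.mul_le_mul_left _ h2
      _ = N * o i := by rw [hw]; ring
  have horder : ∀ i, P.coeff i ≠ 0 →
      (PowerSeries.expandHom k N (d + 1).factorial_ne_zero (P.coeff i)).order =
        ((N * o i : ℕ) : ℕ∞) := by
    intro i hi
    rw [PowerSeries.expandHom_apply, PowerSeries.order_expand,
      ← ENat.natCast_toNat (PowerSeries.order_eq_top.not.2 hi)]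
    simp [ho]
  set P' := P.map (PowerSeries.expandHom k N (d + 1).factorial_ne_zero) with hP'
  have hP'm : P'.Monic := hP.map _
  have hP'd : P'.natDegree = d + 1 := by rw [hP', hP.natDegree_map, hd]
  obtain ⟨Q, hQ, hQd, hQs⟩ := Polynomial.exists_scaleRoots_eq hP'm (PowerSeries.X ^ r) (by
    intro i hi
    rw [hP'd] at hi ⊢
    rcases hi.eq_or_lt with rfl | hi
    · simp
    rw [hP', Polynomial.coeff_map]
    by_cases h0 : P.coeff i = 0
    · simp [h0]
    rw [← pow_mul, PowerSeries.X_pow_dvd_iff]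
    intro m hm
    refine PowerSeries.coeff_of_lt_order _ ?_
    rw [horder i h0]
    exact_mod_cast hm.trans_le (hle i (Finset.mem_filter.2 ⟨Finset.mem_range.2 hi, h0⟩)))
  rw [hP'd] at hQd
  have hcoeff : ∀ i, Q.coeff i * (PowerSeries.X ^ r) ^ (d + 1 - i) =
      PowerSeries.expandHom k N (d + 1).factorial_ne_zero (P.coeff i) := by
    intro i
    rw [← Polynomial.coeff_map, ← hP', ← hQs, Polynomial.coeff_scaleRoots, hQd]
  refine ⟨PowerSeries.X ^ r, Q, hQ, hQd, hQs, fun c hc => ?_⟩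
  have hQ0 : Q.coeff d = 0 := by
    have := hcoeff d
    rw [hdep, map_zero] at this
    exact (mul_eq_zero.1 this).resolve_right (pow_ne_zero _ (pow_ne_zero _ PowerSeries.X_ne_zero))
  -- The coefficient of degree `d` in `(X - c)^(d+1)` is `-(d+1)c`; it must vanish. But `X^(d+1)` is
  -- also excluded, because the coefficient at `i₀`, which attains the slope, survives in the
  -- residue.
  have hc0 : c = 0 := by
    have h1 := congrArg (fun p => Polynomial.coeff p d) hc
    simp only [Polynomial.coeff_map, hQ0, map_zero] at h1
    rw [sub_eq_add_neg, ← map_neg, Polynomial.coeff_X_add_C_pow] at h1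
    have h2 : ((d : k) + 1) ≠ 0 := Nat.cast_add_one_ne_zero d
    simpa [h2] using h1
  have hQi₀ : PowerSeries.constantCoeff (Q.coeff i₀) ≠ 0 := by
    intro h0
    obtain ⟨g, hg⟩ := PowerSeries.X_dvd_iff.2 h0
    have h1 := hcoeff i₀
    have h2 := horder i₀ hci₀
    rw [← h1, hg, ← pow_mul, hrN] at h2
    have h3 : PowerSeries.X ^ (N * o i₀ + 1) ∣
        PowerSeries.X * g * PowerSeries.X ^ (N * o i₀) := ⟨g, by ring⟩
    have h4 := PowerSeries.X_pow_dvd_iff.1 h3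
    have h5 := PowerSeries.le_order _ ((N * o i₀ + 1 : ℕ) : ℕ∞) fun i hi => h4 i (by exact_mod_cast hi)
    rw [h2] at h5
    have : N * o i₀ + 1 ≤ N * o i₀ := by exact_mod_cast h5
    omega
  apply hQi₀
  have h1 := congrArg (fun p => Polynomial.coeff p i₀) hc
  simpa [hc0, Polynomial.coeff_X_pow, hi₀.ne] using h1

/-- Induction by translation to a depressed polynomial, Newton polygon step and factorization. The
index `M` depends on `d` alone so that one substitution splits both factors; it is far from optimal.
-/
theorem PowerSeries.exists_splits_map_expand (k : Type*) [Field k] [IsAlgClosed k] [CharZero k]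
    (d : ℕ) :
    ∃ (M : ℕ) (hM : M ≠ 0), ∀ P : Polynomial (PowerSeries k), P.Monic → P.natDegree ≤ d →
      (P.map (PowerSeries.expandHom k M hM)).Splits := by
  induction d with
  | zero =>
    refine ⟨1, one_ne_zero, fun P hP hd => ?_⟩
    exact Polynomial.Splits.of_natDegree_eq_zero (by rw [hP.natDegree_map]; omega)
  | succ d ih =>
    obtain ⟨M, hM, ih⟩ := ih
    refine ⟨M * (d + 1).factorial, mul_ne_zero hM (d + 1).factorial_ne_zero, fun P hP hd => ?_⟩
    rcases hd.lt_or_eq with hd | hd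
    · have := (ih P hP (by omega)).map
        (PowerSeries.expandHom k (d + 1).factorial (d + 1).factorial_ne_zero)
      rw [Polynomial.map_map, PowerSeries.expandHom_comp] at this
      simpa only [mul_comm] using this
    rw [← PowerSeries.expandHom_comp (d + 1).factorial_ne_zero hM, ← Polynomial.map_map]
    set φ := PowerSeries.expandHom k (d + 1).factorial (d + 1).factorial_ne_zero
    set ψ := PowerSeries.expandHom k M hM
    have hd0 : ((d + 1 : ℕ) : k) ≠ 0 := Nat.cast_ne_zero.2 (Nat.succ_ne_zero d)
    set c : PowerSeries k := - (PowerSeries.C ((d + 1 : ℕ) : k)⁻¹ * P.coeff d)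
    have hTm : (P.taylor c).Monic := by rw [Polynomial.taylor_apply]; exact hP.comp_X_add_C _
    have hTd : (P.taylor c).natDegree = d + 1 := by rw [Polynomial.natDegree_taylor, hd]
    have hdep : (P.taylor c).coeff d = 0 := by
      rw [Polynomial.coeff_taylor_of_natDegree_eq_succ c hd, ← hd, hP.coeff_natDegree, hd]
      have : ((d + 1 : ℕ) : PowerSeries k) = PowerSeries.C ((d + 1 : ℕ) : k) := by simp
      rw [this, mul_one, mul_neg, ← mul_assoc, ← map_mul, mul_inv_cancel₀ hd0, map_one, one_mul,
        add_neg_cancel]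
    refine Polynomial.Splits.of_taylor (ψ (φ c)) ?_
    rw [← Polynomial.map_taylor, ← Polynomial.map_taylor]
    by_cases hX : P.taylor c = Polynomial.X ^ (d + 1)
    · rw [hX, Polynomial.map_pow, Polynomial.map_pow, Polynomial.map_X, Polynomial.map_X]
      exact Polynomial.Splits.X_pow _
    obtain ⟨s, Q, hQ, hQd, hQs, hQc⟩ :=
      PowerSeries.exists_scaleRoots_of_depressed hTm hTd hdep hX
    obtain ⟨b, f, g, hf, hg, hfd, hgd, hfg⟩ := PowerSeries.exists_monic_factor hQ (by omega)
      (by rwa [hQd])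
    rw [← hQs, Polynomial.map_scaleRoots _ _ _ (by rw [hQ.leadingCoeff, map_one]; exact one_ne_zero)]
    refine Polynomial.Splits.scaleRoots (Polynomial.Splits.of_taylor (ψ b) ?_) _
    rw [← Polynomial.map_taylor, hfg, Polynomial.map_mul]
    exact (ih f hf (by omega)).mul (ih g hg (by omega))

/-- **Newton–Puiseux** with the exact ramification index `d!`. -/
theorem PowerSeries.splits_map_expand_factorial [IsAlgClosed k] [CharZero k]
    {P : Polynomial (PowerSeries k)} (hP : P.Monic) :
    (P.map (PowerSeries.expandHom k _ P.natDegree.factorial_ne_zero)).Splits := by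
  classical
  set d := P.natDegree with hd
  obtain ⟨M, hM, h⟩ := PowerSeries.exists_splits_map_expand k d
  have hsplit := (h P hP hd.ge).map (PowerSeries.expandHom k d.factorial d.factorial_ne_zero)
  rw [Polynomial.map_map, PowerSeries.expandHom_comp] at hsplit
  simp only [mul_comm d.factorial M] at hsplit
  have hN := mul_ne_zero hM d.factorial_ne_zero
  set N := M * d.factorial with hNdef
  have hNk : NeZero (N : k) := ⟨Nat.cast_ne_zero.2 hN⟩
  have : NeZero N := ⟨hN⟩
  obtain ⟨ζ, hζ⟩ := HasEnoughRootsOfUnity.exists_primitiveRoot k N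
  set P' := P.map (PowerSeries.expandHom k N hN) with hP'
  have hfix : ∀ r : ℕ, P'.map (PowerSeries.rescale (ζ ^ r)) = P' := by
    intro r
    rw [hP', Polynomial.map_map]
    congr 1
    ext f m
    simp only [RingHom.comp_apply, PowerSeries.coeff_rescale, PowerSeries.expandHom_apply,
      PowerSeries.coeff_expand]
    split_ifs with hm
    · obtain ⟨q, rfl⟩ := hm
      rw [← pow_mul, show r * (N * q) = N * (r * q) by ring, pow_mul, hζ.pow_eq_one, one_pow,
        one_mul]
    · rw [mul_zero]
  have hP'm : P'.Monic := hP.map _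
  have hP'd : P'.natDegree = d := by rw [hP', hP.natDegree_map]
  have hroot : ∀ η ∈ P'.roots, η ∈ (PowerSeries.expandHom k M hM).range := by
    intro η hη
    -- The substitutions `t ↦ ζʳ t` permute the at most `d` roots of `P'`, so two of the `d + 1`
    -- exponents `r` give the same conjugate of `η`.
    have hmaps : ∀ r ∈ Finset.range (d + 1),
        PowerSeries.rescale (ζ ^ r) η ∈ P'.roots.toFinset := by
      intro r _
      rw [Multiset.mem_toFinset, Polynomial.mem_roots hP'm.ne_zero, ← hfix r]
      exact (Polynomial.isRoot_of_mem_roots hη).map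
    have hcard : P'.roots.toFinset.card < (Finset.range (d + 1)).card := by
      rw [Finset.card_range]
      have := (Multiset.toFinset_card_le P'.roots).trans (Polynomial.card_roots' P')
      omega
    obtain ⟨r, hr, s, hs, hrs, heq⟩ := Finset.exists_ne_map_eq_of_card_lt_of_maps_to hcard hmaps
    wlog hlt : r < s generalizing r s
    · exact this s hs r hr hrs.symm heq.symm (by omega)
    rw [Finset.mem_range] at hs
    have hdvd : ∀ m, PowerSeries.coeff m η ≠ 0 → M ∣ m := by
      intro m hm
      have h1 := congrArg (PowerSeries.coeff m) heq
      rw [PowerSeries.coeff_rescale, PowerSeries.coeff_rescale] at h1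
      have h2 := mul_right_cancel₀ hm h1
      rw [← pow_mul, ← pow_mul] at h2
      have hζ0 : ζ ≠ 0 := hζ.ne_zero hN
      have h3 : ζ ^ ((s - r) * m) = 1 := by
        have : s * m = r * m + (s - r) * m := by rw [← add_mul]; congr 1; omega
        rw [this, pow_add] at h2
        exact mul_left_cancel₀ (pow_ne_zero (r * m) hζ0) (by rw [← h2, mul_one])
      have h4 := hζ.dvd_of_pow_eq_one _ h3
      -- As `0 < s - r ≤ d`, every exponent `m` of `η` satisfies `M d! ∣ d! m`: the factor `M` of
      -- the ramification is superfluous.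
      have h5 : s - r ∣ d.factorial := Nat.dvd_factorial (by omega) (by omega)
      have h6 : N ∣ d.factorial * m := h4.trans (Nat.mul_dvd_mul_right h5 m)
      rw [hNdef, mul_comm M] at h6
      exact Nat.dvd_of_mul_dvd_mul_left d.factorial_pos h6
    refine ⟨PowerSeries.mk fun m => PowerSeries.coeff (M * m) η, ?_⟩
    ext m
    rw [PowerSeries.expandHom_apply, PowerSeries.coeff_expand]
    split_ifs with hm
    · rw [PowerSeries.coeff_mk, Nat.mul_div_cancel' hm]
    · by_contra h0
      exact hm (hdvd m (Ne.symm h0))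
  have hP'' : (P.map (PowerSeries.expandHom k _ d.factorial_ne_zero)).map
      (PowerSeries.expandHom k M hM) = P' := by
    rw [Polynomial.map_map, PowerSeries.expandHom_comp]
  refine Polynomial.Splits.of_splits_map_of_injective (i := PowerSeries.expandHom k M hM)
    (PowerSeries.expandHom_injective hM) ?_ ?_
  · rwa [hP'']
  · rwa [hP'']

end NewtonPuiseux

/-! ### Taylor series along commuting derivations -/

section Taylor

variable {σ : Type*} {K : Type*} [Field K]

/-- The induction step on total degree for the Taylor identities: in characteristic zero a series is
determined by its constant term and its derivatives. -/
theorem MvPowerSeries.coeff_eq_zero_of_coeff_pderiv_eq_zero [CharZero K] {f : MvPowerSeries σ K} {n : ℕ}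
    (h : ∀ i (a : σ →₀ ℕ), a.degree = n → MvPowerSeries.coeff a (MvPowerSeries.pderiv K i f) = 0)
    {a : σ →₀ ℕ} (ha : a.degree = n + 1) : MvPowerSeries.coeff a f = 0 := by
  have ha0 : a ≠ 0 := by rintro rfl; simp at ha
  obtain ⟨i, hi⟩ := Finsupp.ne_iff.1 ha0
  have hle : Finsupp.single i 1 ≤ a := by
    rw [Finsupp.single_le_iff]; exact Nat.one_le_iff_ne_zero.2 hi
  have hsub := tsub_add_cancel_of_le hle
  have hdeg : (a - Finsupp.single i 1).degree = n := by
    have := congrArg Finsupp.degree hsub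
    rw [map_add, Finsupp.degree_single, ha] at this
    omega
  have := h i _ hdeg
  rw [MvPowerSeries.coeff_pderiv, hsub] at this
  exact (mul_eq_zero.1 this).resolve_right (Nat.cast_add_one_ne_zero _)

variable {B : Type*} [CommRing B]

theorem pairwise_commute_powersHom_derivation (D : σ → Derivation ℤ B B)
    (hD : ∀ i j b, D i (D j b) = D j (D i b)) :
    Pairwise fun i j => ∀ x y : Multiplicative ℕ,
      Commute (powersHom (Module.End ℤ B) (D i : B →ₗ[ℤ] B) x)
        (powersHom (Module.End ℤ B) (D j : B →ₗ[ℤ] B) y) := by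
  intro i j _ m n
  have : Commute (D i : Module.End ℤ B) (D j : Module.End ℤ B) := LinearMap.ext fun b => hD i j b
  simpa using this.pow_pow _ _

variable [Fintype σ]

/-- The iterated derivative `∂ᵃ` of a commuting family of derivations. -/
noncomputable def iteratedDerivation (D : σ → Derivation ℤ B B)
    (hD : ∀ i j b, D i (D j b) = D j (D i b)) (a : σ →₀ ℕ) : Module.End ℤ B :=
  MonoidHom.noncommPiCoprod (fun i => powersHom (Module.End ℤ B) (D i : B →ₗ[ℤ] B))
    (pairwise_commute_powersHom_derivation D hD) (fun i => Multiplicative.ofAdd (a i))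

variable (D : σ → Derivation ℤ B B) (hD : ∀ i j b, D i (D j b) = D j (D i b))

theorem iteratedDerivation_zero (b : B) : iteratedDerivation D hD 0 b = b := by
  have : (fun i : σ => Multiplicative.ofAdd ((0 : σ →₀ ℕ) i)) = 1 := rfl
  rw [iteratedDerivation, this, map_one]
  rfl

theorem iteratedDerivation_add_single (a : σ →₀ ℕ) (i : σ) (b : B) :
    iteratedDerivation D hD (a + Finsupp.single i 1) b = iteratedDerivation D hD a (D i b) := by
  classical
  have : (fun j : σ => Multiplicative.ofAdd ((a + Finsupp.single i 1 : σ →₀ ℕ) j)) =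
      (fun j => Multiplicative.ofAdd (a j)) * Pi.mulSingle i (Multiplicative.ofAdd 1) := by
    funext j
    rcases eq_or_ne i j with rfl | h
    · simp
    · simp [h]
  rw [iteratedDerivation, this, map_mul, MonoidHom.noncommPiCoprod_mulSingle]
  simp [iteratedDerivation]

/-- The Taylor series `∑ₐ χ(∂ᵃ b) / a! · xᵃ`. -/
noncomputable def taylorSeries (χ : B →+* K) (b : B) : MvPowerSeries σ K :=
  fun a => χ (iteratedDerivation D hD a b) / ∏ i, ((a i).factorial : K)

variable (χ : B →+* K)

theorem coeff_taylorSeries (b : B) (a : σ →₀ ℕ) :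
    MvPowerSeries.coeff a (taylorSeries D hD χ b) =
      χ (iteratedDerivation D hD a b) / ∏ i, ((a i).factorial : K) := rfl

theorem constantCoeff_taylorSeries (b : B) :
    MvPowerSeries.constantCoeff (taylorSeries D hD χ b) = χ b := by
  rw [← MvPowerSeries.coeff_zero_eq_constantCoeff_apply, coeff_taylorSeries,
    iteratedDerivation_zero]
  simp

theorem taylorSeries_add (b c : B) :
    taylorSeries D hD χ (b + c) = taylorSeries D hD χ b + taylorSeries D hD χ c := by
  ext a
  simp only [map_add, coeff_taylorSeries, add_div]

variable [CharZero K]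

theorem pderiv_taylorSeries (i : σ) (b : B) :
    MvPowerSeries.pderiv K i (taylorSeries D hD χ b) = taylorSeries D hD χ (D i b) := by
  classical
  ext a
  rw [MvPowerSeries.coeff_pderiv, coeff_taylorSeries, coeff_taylorSeries,
    iteratedDerivation_add_single]
  have hprod : ∏ j, (((a + Finsupp.single i 1 : σ →₀ ℕ) j).factorial : K) =
      (∏ j, ((a j).factorial : K)) * (a i + 1) := by
    rw [← Finset.mul_prod_erase _ _ (Finset.mem_univ i),
      ← Finset.mul_prod_erase _ (fun j => ((a j).factorial : K)) (Finset.mem_univ i)]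
    have : ∏ j ∈ Finset.univ.erase i, (((a + Finsupp.single i 1 : σ →₀ ℕ) j).factorial : K) =
        ∏ j ∈ Finset.univ.erase i, ((a j).factorial : K) := by
      refine Finset.prod_congr rfl fun j hj => ?_
      simp [(Finset.ne_of_mem_erase hj).symm]
    rw [this]
    simp [Nat.factorial_succ]
    ring
  rw [hprod]
  have h1 : ((a i : K) + 1) ≠ 0 := Nat.cast_add_one_ne_zero _
  rw [← div_div, div_mul_cancel₀ _ h1]

/-- Both sides have the same constant term and, by `pderiv_taylorSeries` and induction on the
degree, the same derivatives. This avoids the higher Leibniz formula. -/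
theorem taylorSeries_mul (b c : B) :
    taylorSeries D hD χ (b * c) = taylorSeries D hD χ b * taylorSeries D hD χ c := by
  rw [← sub_eq_zero]
  ext a
  induction hn : a.degree generalizing a b c with
  | zero =>
    rw [Finsupp.degree_eq_zero_iff] at hn
    subst hn
    simp [constantCoeff_taylorSeries]
  | succ n ih =>
    refine MvPowerSeries.coeff_eq_zero_of_coeff_pderiv_eq_zero (n := n) (fun i a' ha' => ?_) hn
    have h1 := ih (D i b) c a' ha'
    have h2 := ih b (D i c) a' ha'
    rw [map_zero] at h1 h2
    rw [map_sub, Derivation.leibniz, pderiv_taylorSeries, pderiv_taylorSeries, pderiv_taylorSeries,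
      Derivation.leibniz, taylorSeries_add, smul_eq_mul, smul_eq_mul, smul_eq_mul, smul_eq_mul,
      mul_comm c, mul_comm (taylorSeries D hD χ c)]
    rw [← add_zero (0 : K)]
    nth_rewrite 1 [← h2]
    rw [← h1, ← map_add]
    congr 1
    ring

/-- The Taylor series homomorphism. -/
noncomputable def taylorSeriesHom : B →+* MvPowerSeries σ K where
  toFun := taylorSeries D hD χ
  map_one' := by
    ext a
    rw [← sub_eq_zero, ← map_sub]
    induction hn : a.degree with
    | zero =>
      rw [Finsupp.degree_eq_zero_iff] at hn
      subst hn
      simp [constantCoeff_taylorSeries]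
    | succ n ih =>
      refine MvPowerSeries.coeff_eq_zero_of_coeff_pderiv_eq_zero (n := n) (fun i a' ha' => ?_) hn
      have h0 : taylorSeries D hD χ 0 = 0 := by simpa using taylorSeries_add D hD χ 0 0
      simp [pderiv_taylorSeries, h0]
  map_mul' := taylorSeries_mul D hD χ
  map_zero' := by simpa using taylorSeries_add D hD χ 0 0
  map_add' := taylorSeries_add D hD χ

/-- A power series is its own Taylor series at the origin. Hence the Taylor map carries roots in `B`
of a polynomial over `K⟦x⟧` to roots in `K⟦x⟧`. -/
theorem taylorSeriesHom_comp_eq_id (ι : MvPowerSeries σ K →+* B)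
    (hι : ∀ i f, D i (ι f) = ι (MvPowerSeries.pderiv K i f))
    (hχ : χ.comp ι = MvPowerSeries.constantCoeff) :
    (taylorSeriesHom D hD χ).comp ι = RingHom.id _ := by
  ext f a
  rw [← sub_eq_zero, ← map_sub]
  induction hn : a.degree generalizing a f with
  | zero =>
    rw [Finsupp.degree_eq_zero_iff] at hn
    subst hn
    have := RingHom.congr_fun hχ f
    simp only [RingHom.comp_apply] at this
    simp [taylorSeriesHom, constantCoeff_taylorSeries, this]
  | succ n ih =>
    refine MvPowerSeries.coeff_eq_zero_of_coeff_pderiv_eq_zero (n := n) (fun i a' ha' => ?_) hn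
    have h1 := ih (MvPowerSeries.pderiv K i f) a' ha'
    rw [← h1]
    simp only [taylorSeriesHom, RingHom.comp_apply, RingHom.coe_mk, MonoidHom.coe_mk,
      OneHom.coe_mk, RingHom.id_apply, map_sub, pderiv_taylorSeries, hι]

end Taylor

/-! ### Derivations and their extension along étale maps -/

section RingDerivation

variable {A M : Type*} [CommRing A] [AddCommGroup M] [Module A M]

/-- Additive derivations of a commutative ring, with the canonical `ℤ`-structures. -/
abbrev RingDerivation (A M : Type*) [CommRing A] [AddCommGroup M] [Module A M] : Type _ :=
  Derivation ℤ A M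

/-- An additive map which satisfies the Leibniz rule is a derivation. -/
def RingDerivation.ofLeibniz (f : A →+ M) (h : ∀ a b, f (a * b) = a • f b + b • f a) :
    RingDerivation A M :=
  Derivation.mk' f.toIntLinearMap h

theorem RingDerivation.ofLeibniz_apply (f : A →+ M) (h : ∀ a b, f (a * b) = a • f b + b • f a)
    (a : A) : RingDerivation.ofLeibniz f h a = f a := rfl

/-- The composite of a derivation with a linear map. -/
def RingDerivation.comp {N : Type*} [AddCommGroup N] [Module A N] (g : M →ₗ[A] N)
    (D : RingDerivation A M) : RingDerivation A N :=
  .ofLeibniz (g.toAddMonoidHom.comp (D : A →ₗ[ℤ] M).toAddMonoidHom) fun a b => by simp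

theorem RingDerivation.comp_apply {N : Type*} [AddCommGroup N] [Module A N] (g : M →ₗ[A] N)
    (D : RingDerivation A M) (a : A) : RingDerivation.comp g D a = g (D a) := rfl

end RingDerivation

section ExtendDerivation

variable {A B M : Type*} [CommRing A] [CommRing B] [Algebra A B] [AddCommGroup M] [Module A M]
  [Module B M] [IsScalarTower A B M]

/-- The difference is `A`-linear, so it factors through `Ω[B⁄A] = 0`. -/
theorem RingDerivation.ext_of_formallyUnramified [Algebra.FormallyUnramified A B]
    {D₁ D₂ : RingDerivation B M}
    (h : ∀ a, D₁ (algebraMap A B a) = D₂ (algebraMap A B a)) : D₁ = D₂ := by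
  let E : Derivation A B M := Derivation.mk'
    { toFun := fun b => D₁ b - D₂ b
      map_add' := fun b c => by simp only [map_add]; abel
      map_smul' := fun a b => by
        simp only [Algebra.smul_def, Derivation.leibniz, h, RingHom.id_apply]
        rw [add_sub_add_right_eq_sub, ← smul_sub, algebraMap_smul] }
    (fun b c => by
      simp only [LinearMap.coe_mk, AddHom.coe_mk, Derivation.leibniz, smul_sub]
      abel)
  have hE : E = 0 := by
    have h0 : E.liftKaehlerDifferential = 0 := by
      refine LinearMap.ext fun x => ?_
      rw [Subsingleton.elim x 0, map_zero, map_zero]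
    rw [← Derivation.liftKaehlerDifferential_comp E, h0]
    ext; simp
  ext b
  exact sub_eq_zero.1 (congrArg (fun d : Derivation A B M => d b) hE)

/-- Derivations extend because `B ⊗ Ω[A⁄ℤ] ≃ Ω[B⁄ℤ]`. -/
theorem RingDerivation.exists_extension_of_formallyEtale [Algebra.FormallyEtale A B]
    (D : RingDerivation A M) :
    ∃ D' : RingDerivation B M, ∀ a, D' (algebraMap A B a) = D a := by
  let ℓ : TensorProduct A B (Ω[A⁄ℤ]) →ₗ[B] M :=
    TensorProduct.AlgebraTensorModule.lift
      { toFun := fun b => b • (D.liftKaehlerDifferential)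
        map_add' := fun b c => add_smul _ _ _
        map_smul' := fun b c => by simp [mul_smul] }
  refine ⟨(ℓ ∘ₗ (KaehlerDifferential.tensorKaehlerEquivOfFormallyEtale ℤ A B).symm.toLinearMap).compDer
    (KaehlerDifferential.D ℤ B), fun a => ?_⟩
  simp [KaehlerDifferential.tensorKaehlerEquivOfFormallyEtale_symm_D_algebraMap, ℓ]

end ExtendDerivation

/-! ### Resolvents -/

section Resolvent

variable {R : Type*} [CommRing R]

/-- The polynomial `∏ (X - g(η))`, where `η` runs over the roots of the monic polynomial `P`. -/
noncomputable def Polynomial.resolvent (P g : Polynomial R) : Polynomial R :=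
  Polynomial.resultant (P.map Polynomial.C) (Polynomial.C Polynomial.X - g.map Polynomial.C)
    P.natDegree g.natDegree

/-- A resultant with prescribed degrees commutes with base change, and over `V` it is a product over
the roots of the first polynomial. -/
theorem Polynomial.map_resolvent {V : Type*} [CommRing V] [IsDomain V] {P : Polynomial R}
    (hP : P.Monic) (g : Polynomial R) (h : R →+* V) (hs : (P.map h).Splits) :
    (Polynomial.resolvent P g).map h =
      ((P.map h).roots.map fun η =>
        (Polynomial.X - Polynomial.C ((g.map h).eval η) : Polynomial V)).prod := by
  have hC : ∀ p : Polynomial R, (p.map Polynomial.C).map (Polynomial.mapRingHom h) =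
      (p.map h).map Polynomial.C := by
    intro p
    rw [Polynomial.map_map, Polynomial.map_map]
    congr 1
    ext1 r; simp
  have h1 : (Polynomial.resolvent P g).map h =
      Polynomial.resultant ((P.map h).map Polynomial.C)
        (Polynomial.C Polynomial.X - (g.map h).map Polynomial.C) P.natDegree g.natDegree := by
    rw [← hC, ← hC, show Polynomial.C Polynomial.X = (Polynomial.C (Polynomial.X : Polynomial R)).map
      (Polynomial.mapRingHom h) by simp, ← Polynomial.map_sub, Polynomial.resultant_map_map]
    rfl
  have hm : (P.map h).Monic := hP.map h
  have hdeg : ((P.map h).map Polynomial.C).natDegree = P.natDegree := by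
    rw [hm.natDegree_map, hP.natDegree_map]
  have hgdeg : (Polynomial.C Polynomial.X - (g.map h).map Polynomial.C :
      Polynomial (Polynomial V)).natDegree ≤ g.natDegree := by
    refine (Polynomial.natDegree_sub_le _ _).trans (max_le (by simp) ?_)
    exact Polynomial.natDegree_map_le.trans Polynomial.natDegree_map_le
  have h2 := Polynomial.resultant_eq_prod_eval ((P.map h).map Polynomial.C)
    (Polynomial.C Polynomial.X - (g.map h).map Polynomial.C) g.natDegree hgdeg (hs.map _)
  rw [hdeg] at h2
  rw [h1, h2, (hm.map Polynomial.C).leadingCoeff, one_pow, one_mul,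
    hs.roots_map_of_injective Polynomial.C_injective, Multiset.map_map]
  congr 1
  refine Multiset.map_congr rfl fun η _ => ?_
  simp [Polynomial.eval_map, Polynomial.eval₂_at_apply]

theorem Polynomial.map_algebraicClosure_fractionRing_splits [IsDomain R] (P : Polynomial R) :
    (P.map (algebraMap R (AlgebraicClosure (FractionRing R)))).Splits :=
  IsAlgClosed.splits _

theorem Polynomial.algebraMap_algebraicClosure_fractionRing_injective [IsDomain R] :
    Function.Injective (algebraMap R (AlgebraicClosure (FractionRing R))) := by
  rw [IsScalarTower.algebraMap_eq R (FractionRing R) (AlgebraicClosure (FractionRing R))]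
  exact (algebraMap (FractionRing R) _).injective.comp (IsFractionRing.injective R _)

theorem Polynomial.monic_resolvent [IsDomain R] {P : Polynomial R} (hP : P.Monic)
    (g : Polynomial R) : (Polynomial.resolvent P g).Monic := by
  refine Polynomial.monic_of_injective
    Polynomial.algebraMap_algebraicClosure_fractionRing_injective ?_
  rw [Polynomial.map_resolvent hP g _ P.map_algebraicClosure_fractionRing_splits]
  exact Polynomial.monic_multiset_prod_of_monic _ _ fun _ _ => Polynomial.monic_X_sub_C _

/-- Over an algebraic closure each factor `X - η` of `P` divides `g - g(η)`. Thus the resolvent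
annihilates the class of `g` modulo `P`. -/
theorem Polynomial.dvd_resolvent_comp [IsDomain R] {P : Polynomial R} (hP : P.Monic)
    (g : Polynomial R) : P ∣ (Polynomial.resolvent P g).comp g := by
  have hs := P.map_algebraicClosure_fractionRing_splits
  rw [← Polynomial.map_dvd_map _ Polynomial.algebraMap_algebraicClosure_fractionRing_injective hP,
    Polynomial.map_comp, Polynomial.map_resolvent hP g _ hs, Polynomial.multiset_prod_comp,
    Multiset.map_map]
  nth_rewrite 1 [hs.eq_prod_roots_of_monic (hP.map _)]
  refine Multiset.prod_dvd_prod_of_dvd _ _ fun η _ => ?_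
  simp only [Function.comp_apply, Polynomial.sub_comp, Polynomial.X_comp, Polynomial.C_comp]
  exact Polynomial.X_sub_C_dvd_sub_C_eval

theorem Polynomial.scaleRoots_multiset_prod_X_sub_C {V : Type*} [CommRing V] [IsDomain V]
    (s : V) (t : Multiset V) :
    (t.map fun v => (Polynomial.X - Polynomial.C v : Polynomial V)).prod.scaleRoots s =
      (t.map fun v => (Polynomial.X - Polynomial.C (s * v) : Polynomial V)).prod := by
  induction t using Multiset.induction with
  | empty => simp [Polynomial.one_scaleRoots]
  | cons v t ih =>
    simp only [Multiset.map_cons, Multiset.prod_cons]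
    rw [Polynomial.mul_scaleRoots_of_noZeroDivisors, ih, Polynomial.X_sub_C_scaleRoots,
      mul_comm v s]

end Resolvent

/-! ### Integrality of bounded elements -/

section Integrality

variable {R : Type*} [CommRing R] [IsDomain R] {V : Type*} [CommRing V] [IsDomain V]

/-- Integrality over `R` of elements of a standard étale algebra that take values in `V` at each of
the places `h i : R → V`, which jointly detect divisibility by powers of the denominator `m`. -/
theorem StandardEtalePair.isIntegral_of_forall_mem_range {ι : Type*} (h : ι → R →+* V)
    (E : StandardEtalePair R) {m : R} (hE : E.g = Polynomial.C m)
    (hm : ∀ i, h i m ≠ 0)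
    (hdvd : ∀ (r : ℕ) (f : R), (∀ i, h i (m ^ r) ∣ h i f) → m ^ r ∣ f)
    (hs : ∀ i, (E.f.map (h i)).Splits) (b : E.Ring)
    (hb : ∀ i (φ : E.Ring →+* FractionRing V),
      (∀ r, φ (algebraMap R E.Ring r) = algebraMap V (FractionRing V) (h i r)) →
        φ b ∈ (algebraMap V (FractionRing V)).range) :
    IsIntegral R b := by
  let S : StandardEtalePresentation R E.Ring :=
    ⟨E, E.X, E.hasMap_X, by simpa [StandardEtalePair.lift_X_left] using Function.bijective_id⟩
  -- Thus `b = g(y) / m^N`; dividing the roots of the resolvent of `g` by `m^N` should give an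
  -- integral equation for `b`.
  obtain ⟨g, N, hg⟩ := S.exists_mul_aeval_x_g_pow_eq_aeval_x b
  have hSg : S.g = Polynomial.C m := hE
  have hSx : S.x = E.X := rfl
  rw [hSg, hSx, Polynomial.aeval_C, ← map_pow] at hg
  set s := m ^ N with hsdef
  have hunit : IsUnit (algebraMap R E.Ring s) := by
    have := E.hasMap_X.2
    rw [hE, Polynomial.aeval_C] at this
    rw [hsdef, map_pow]
    exact this.pow N
  set Q := Polynomial.resolvent E.f g with hQ
  have hQm : Q.Monic := Polynomial.monic_resolvent E.monic_f g
  have hval : ∀ i, ∃ w : Polynomial V, w.Monic ∧ Q.map (h i) = w.scaleRoots (h i s) := by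
    intro i
    -- Each root `η` defines a homomorphism `y ↦ η` on the étale algebra; boundedness of `b` there
    -- says that `m^N` divides `g(η)` in `V`.
    have hroot : ∀ η ∈ (E.f.map (h i)).roots, ∃ v, (g.map (h i)).eval η = h i s * v := by
      intro η hη
      let _ : Algebra R (FractionRing V) := ((algebraMap V (FractionRing V)).comp (h i)).toAlgebra
      have halg : ∀ r, algebraMap R (FractionRing V) r =
        algebraMap V (FractionRing V) (h i r) := fun r => rfl
      have haev : ∀ p : Polynomial R, Polynomial.aeval (algebraMap V (FractionRing V) η) p =
          algebraMap V (FractionRing V) ((p.map (h i)).eval η) := by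
        intro p
        rw [Polynomial.aeval_def, Polynomial.eval_map, Polynomial.hom_eval₂]
        rfl
      have hmap : E.HasMap (algebraMap V (FractionRing V) η) := by
        refine ⟨?_, ?_⟩
        · rw [haev, Polynomial.isRoot_of_mem_roots hη, map_zero]
        · rw [hE, Polynomial.aeval_C, halg, isUnit_iff_ne_zero]
          exact fun h0 => hm i ((IsFractionRing.injective V (FractionRing V)) (by rw [h0, map_zero]))
      obtain ⟨v, hv⟩ := hb i (E.lift _ hmap).toRingHom (fun r => (E.lift _ hmap).commutes r)
      refine ⟨v, IsFractionRing.injective V (FractionRing V) ?_⟩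
      have h1 := congrArg (E.lift _ hmap) hg
      rw [map_mul, ← Polynomial.aeval_algHom_apply, StandardEtalePair.lift_X, haev,
        AlgHom.commutes, halg] at h1
      rw [← h1, map_mul, hv, mul_comm]
      rfl
    choose! v hv using hroot
    refine ⟨((E.f.map (h i)).roots.map fun η =>
      (Polynomial.X - Polynomial.C (v η) : Polynomial V)).prod,
      Polynomial.monic_multiset_prod_of_monic _ _ fun _ _ => Polynomial.monic_X_sub_C _, ?_⟩
    have := Polynomial.scaleRoots_multiset_prod_X_sub_C (h i s) ((E.f.map (h i)).roots.map v)
    rw [Multiset.map_map, Multiset.map_map] at this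
    rw [hQ, Polynomial.map_resolvent E.monic_f g (h i) (hs i)]
    refine Eq.trans ?_ this.symm
    congr 1
    refine Multiset.map_congr rfl fun η hη => ?_
    rw [Function.comp_apply, hv η hη]
  obtain ⟨Q', hQ'm, -, hQ's⟩ := Polynomial.exists_scaleRoots_eq hQm s (by
    intro j _
    rw [hsdef, ← pow_mul]
    refine hdvd _ _ fun i => ?_
    obtain ⟨w, -, hw⟩ := hval i
    have hwd : w.natDegree = Q.natDegree := by
      rw [← Polynomial.natDegree_scaleRoots w (h i s), ← hw, hQm.natDegree_map]
    rw [← Polynomial.coeff_map, hw, Polynomial.coeff_scaleRoots, hwd, pow_mul, ← hsdef, map_pow]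
    exact dvd_mul_left _ _)
  refine ⟨Q', hQ'm, ?_⟩
  have h0 : Polynomial.aeval (algebraMap R E.Ring s * b) Q = 0 := by
    rw [mul_comm, hg, ← Polynomial.aeval_comp]
    obtain ⟨u, hu⟩ := Polynomial.dvd_resolvent_comp E.monic_f g
    rw [hu, map_mul, E.hasMap_X.1, zero_mul]
  rw [← hQ's, Polynomial.aeval_def, Polynomial.scaleRoots_eval₂_mul] at h0
  exact (hunit.pow _).mul_right_eq_zero.1 h0

end Integrality

/-! ### The places attached to the coordinate hyperplanes -/

section Places

instance MvPowerSeries.isDomain_of_field {σ : Type*} {K : Type*} [Field K] :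
    IsDomain (MvPowerSeries σ K) :=
  NoZeroDivisors.to_isDomain _

variable {σ : Type*} {K : Type*} [Field K]

/-- The part of degree `m` in `xᵢ` of a formal power series. -/
noncomputable def MvPowerSeries.degreePart (i : σ) (m : ℕ) (f : MvPowerSeries σ K) :
    MvPowerSeries σ K :=
  fun a => if a i = m then MvPowerSeries.coeff a f else 0

/-- The series in `t` whose coefficient of `tᵐ` is the part of degree `m` in `xᵢ`. -/
noncomputable def MvPowerSeries.degreeSeriesFun (i : σ) (f : MvPowerSeries σ K) :
    PowerSeries (MvPowerSeries σ K) :=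
  PowerSeries.mk fun m => MvPowerSeries.degreePart i m f

theorem MvPowerSeries.coeff_coeff_degreeSeriesFun (i : σ) (f : MvPowerSeries σ K) (m : ℕ)
    (a : σ →₀ ℕ) :
    MvPowerSeries.coeff a (PowerSeries.coeff m (MvPowerSeries.degreeSeriesFun i f)) =
      if a i = m then MvPowerSeries.coeff a f else 0 := by
  rw [degreeSeriesFun, PowerSeries.coeff_mk]
  rfl

/-- The substitution `xᵢ ↦ xᵢ t`: the coefficient of `tᵐ` is the part of degree `m` in `xᵢ`. -/
noncomputable def MvPowerSeries.degreeSeries (K : Type*) [Field K] (i : σ) :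
    MvPowerSeries σ K →+* PowerSeries (MvPowerSeries σ K) :=
  have hF := MvPowerSeries.coeff_coeff_degreeSeriesFun (K := K) i
  { toFun := MvPowerSeries.degreeSeriesFun i
    map_zero' := by ext m a; rw [hF]; simp
    map_add' := fun f g => by
      ext m a
      rw [map_add, map_add, hF, hF, hF]
      split_ifs <;> simp
    map_one' := by
      classical
      ext m a
      rw [hF, PowerSeries.coeff_one, MvPowerSeries.coeff_one]
      by_cases ha : a = 0
      · subst ha
        by_cases hm : m = 0
        · simp [hm]
        · simp [hm, Ne.symm hm]
      · by_cases hm : m = 0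
        · simp [ha, hm, MvPowerSeries.coeff_one]
        · simp [ha, hm]
    map_mul' := fun f g => by
      classical
      ext m a
      rw [hF, PowerSeries.coeff_mul, map_sum]
      simp only [MvPowerSeries.coeff_mul, hF]
      rw [Finset.sum_comm]
      have key : ∀ p ∈ Finset.HasAntidiagonal.antidiagonal a, ∑ q ∈ Finset.HasAntidiagonal.antidiagonal m,
          ((if p.1 i = q.1 then MvPowerSeries.coeff p.1 f else 0) *
            (if p.2 i = q.2 then MvPowerSeries.coeff p.2 g else 0)) =
          if a i = m then MvPowerSeries.coeff p.1 f * MvPowerSeries.coeff p.2 g else 0 := by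
        intro p hp
        have hpa : p.1 i + p.2 i = a i := by
          rw [← Finset.HasAntidiagonal.mem_antidiagonal.1 hp]; rfl
        split_ifs with h
        · rw [Finset.sum_eq_single (p.1 i, p.2 i)]
          · simp
          · intro q hq hne
            by_cases h1 : p.1 i = q.1
            · have h2 : p.2 i ≠ q.2 := fun h2 => hne (Prod.ext h1.symm h2.symm)
              rw [if_neg h2, mul_zero]
            · rw [if_neg h1, zero_mul]
          · intro hnot
            exact absurd (Finset.HasAntidiagonal.mem_antidiagonal.2 (hpa.trans h)) hnot
        · refine Finset.sum_eq_zero fun q hq => ?_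
          have hqm := Finset.HasAntidiagonal.mem_antidiagonal.1 hq
          by_cases h1 : p.1 i = q.1
          · have h2 : p.2 i ≠ q.2 := fun h2 => h (by omega)
            rw [if_neg h2, mul_zero]
          · rw [if_neg h1, zero_mul]
      rw [Finset.sum_congr rfl key]
      split_ifs <;> simp }

theorem MvPowerSeries.coeff_coeff_degreeSeries (i : σ) (f : MvPowerSeries σ K) (m : ℕ)
    (a : σ →₀ ℕ) :
    MvPowerSeries.coeff a (PowerSeries.coeff m (MvPowerSeries.degreeSeries K i f)) =
      if a i = m then MvPowerSeries.coeff a f else 0 :=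
  MvPowerSeries.coeff_coeff_degreeSeriesFun i f m a

theorem MvPowerSeries.coeff_degreeSeries_pderiv_of_ne {i l : σ} (h : l ≠ i)
    (f : MvPowerSeries σ K) (m : ℕ) :
    PowerSeries.coeff m (MvPowerSeries.degreeSeries K i (MvPowerSeries.pderiv K l f)) =
      MvPowerSeries.pderiv K l (PowerSeries.coeff m (MvPowerSeries.degreeSeries K i f)) := by
  ext a
  rw [coeff_coeff_degreeSeries, coeff_pderiv, coeff_pderiv, coeff_coeff_degreeSeries]
  simp [h]

/-- The chain rule for `xᵢ ↦ xᵢ t`: the operator `xᵢ ∂/∂xᵢ`, with its outer `xᵢ` left unsubstituted,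
becomes `d/dt`. -/
theorem MvPowerSeries.X_mul_coeff_degreeSeries_pderiv (i : σ) (f : MvPowerSeries σ K) (m : ℕ) :
    MvPowerSeries.X i *
        PowerSeries.coeff m (MvPowerSeries.degreeSeries K i (MvPowerSeries.pderiv K i f)) =
      PowerSeries.coeff (m + 1) (MvPowerSeries.degreeSeries K i f) *
        ((m : MvPowerSeries σ K) + 1) := by
  classical
  ext a
  have hr : MvPowerSeries.coeff a
      (PowerSeries.coeff (m + 1) (MvPowerSeries.degreeSeries K i f) * ((m : MvPowerSeries σ K) + 1)) =
      (if a i = m + 1 then MvPowerSeries.coeff a f else 0) * (m + 1) := by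
    have : ((m : MvPowerSeries σ K) + 1) = MvPowerSeries.C ((m : K) + 1) := by simp
    rw [this, MvPowerSeries.coeff_mul_C, coeff_coeff_degreeSeries]
  rw [hr, MvPowerSeries.X, MvPowerSeries.coeff_monomial_mul]
  simp only [Finsupp.single_le_iff, one_mul]
  split_ifs with h1 h2 h2
  · rw [coeff_coeff_degreeSeries, coeff_pderiv,
      tsub_add_cancel_of_le (Finsupp.single_le_iff.2 h1)]
    simp [h2]
  · rw [coeff_coeff_degreeSeries, if_neg, zero_mul]
    simp only [Finsupp.coe_tsub, Pi.sub_apply, Finsupp.single_eq_same]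
    omega
  · omega
  · simp

theorem MvPowerSeries.X_dvd_degreeSeries_X (i : σ) :
    PowerSeries.X ∣ MvPowerSeries.degreeSeries K i (MvPowerSeries.X i) := by
  classical
  rw [PowerSeries.X_dvd_iff, ← PowerSeries.coeff_zero_eq_constantCoeff_apply]
  ext a
  rw [coeff_coeff_degreeSeries, MvPowerSeries.coeff_X]
  split_ifs with h1 h2
  · subst h2; simp at h1
  · simp
  · simp

theorem MvPowerSeries.X_pow_dvd_of_degreeSeries_coeff_eq_zero (i : σ) (f : MvPowerSeries σ K)
    (r : ℕ) (h : ∀ m < r, PowerSeries.coeff m (MvPowerSeries.degreeSeries K i f) = 0) :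
    MvPowerSeries.X i ^ r ∣ f := by
  rw [MvPowerSeries.X_pow_dvd_iff]
  intro a ha
  have := congrArg (MvPowerSeries.coeff a) (h (a i) ha)
  rwa [coeff_coeff_degreeSeries, if_pos rfl, map_zero] at this

theorem MvPowerSeries.monomial_dvd_of_forall_X_pow_dvd (α : σ →₀ ℕ) (f : MvPowerSeries σ K)
    (h : ∀ i, MvPowerSeries.X i ^ α i ∣ f) : MvPowerSeries.monomial α (1 : K) ∣ f := by
  classical
  let g : MvPowerSeries σ K := fun a : σ →₀ ℕ => MvPowerSeries.coeff (a + α) f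
  refine ⟨g, ?_⟩
  ext a
  rw [MvPowerSeries.coeff_monomial_mul, one_mul]
  split_ifs with ha
  · change _ = MvPowerSeries.coeff (a - α + α) f
    rw [tsub_add_cancel_of_le ha]
  · obtain ⟨i, hi⟩ := not_forall.1 ha
    exact MvPowerSeries.X_pow_dvd_iff.1 (h i) a (not_le.1 hi)

theorem MvPowerSeries.X_pow_dvd_monomial (α : σ →₀ ℕ) (i : σ) :
    MvPowerSeries.X i ^ α i ∣ MvPowerSeries.monomial α (1 : K) := by
  classical
  rw [MvPowerSeries.X_pow_dvd_iff]
  intro a ha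
  rw [MvPowerSeries.coeff_monomial, if_neg]
  rintro rfl
  exact ha.ne rfl

/-- An algebraically closed field containing `K⟦x⟧`. -/
abbrev PlaceField (σ K : Type*) [Field K] : Type _ :=
  AlgebraicClosure (FractionRing (MvPowerSeries σ K))

/-- The embedding of `K⟦x⟧` in a ring of formal power series in one variable `t` which sends
`xᵢ` to `xᵢ t` and so makes the divisor `xᵢ = 0` visible. -/
noncomputable def placeHom (K : Type*) [Field K] (i : σ) :
    MvPowerSeries σ K →+* PowerSeries (PlaceField σ K) :=
  (PowerSeries.map (algebraMap (MvPowerSeries σ K) (PlaceField σ K))).comp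
    (MvPowerSeries.degreeSeries K i)

theorem algebraMap_placeField_injective :
    Function.Injective (algebraMap (MvPowerSeries σ K) (PlaceField σ K)) :=
  Polynomial.algebraMap_algebraicClosure_fractionRing_injective

theorem coeff_placeHom (i : σ) (f : MvPowerSeries σ K) (m : ℕ) :
    PowerSeries.coeff m (placeHom K i f) = algebraMap (MvPowerSeries σ K) (PlaceField σ K)
      (PowerSeries.coeff m (MvPowerSeries.degreeSeries K i f)) := by
  simp [placeHom]

theorem placeHom_injective (i : σ) : Function.Injective (placeHom K i) := by
  rw [injective_iff_map_eq_zero]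
  intro f hf
  ext a
  have h1 : PowerSeries.coeff (a i) (MvPowerSeries.degreeSeries K i f) = 0 := by
    apply algebraMap_placeField_injective
    rw [← coeff_placeHom, hf, map_zero, map_zero]
  have := congrArg (MvPowerSeries.coeff a) h1
  rwa [MvPowerSeries.coeff_coeff_degreeSeries, if_pos rfl, map_zero] at this

/-- The order in `t` at place `i` is the order along `xᵢ = 0`, and divisibility by a monomial can be
tested one variable at a time. -/
theorem monomial_dvd_of_forall_placeHom_dvd (α : σ →₀ ℕ) (f : MvPowerSeries σ K)
    (h : ∀ i, placeHom K i (MvPowerSeries.monomial α 1) ∣ placeHom K i f) :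
    MvPowerSeries.monomial α (1 : K) ∣ f := by
  refine MvPowerSeries.monomial_dvd_of_forall_X_pow_dvd α f fun i => ?_
  refine MvPowerSeries.X_pow_dvd_of_degreeSeries_coeff_eq_zero i f _ fun m hm => ?_
  apply algebraMap_placeField_injective
  rw [← coeff_placeHom, map_zero]
  have h1 : (PowerSeries.X : PowerSeries (PlaceField σ K)) ∣ placeHom K i (MvPowerSeries.X i) := by
    have := map_dvd (PowerSeries.map (algebraMap (MvPowerSeries σ K) (PlaceField σ K)))
      (MvPowerSeries.X_dvd_degreeSeries_X (K := K) i)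
    rwa [PowerSeries.map_X] at this
  have h2 := map_dvd (placeHom K i) (MvPowerSeries.X_pow_dvd_monomial (K := K) α i)
  rw [map_pow] at h2
  exact PowerSeries.X_pow_dvd_iff.1 (((pow_dvd_pow_of_dvd h1 _).trans h2).trans (h i)) m hm

theorem MvPowerSeries.degreeSeries_expand (i : σ) {N : ℕ} (hN : N ≠ 0) (f : MvPowerSeries σ K) :
    MvPowerSeries.degreeSeries K i (MvPowerSeries.expand N hN f) =
      PowerSeries.expand N hN (PowerSeries.map (MvPowerSeries.expand N hN).toRingHom
        (MvPowerSeries.degreeSeries K i f)) := by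
  classical
  ext m a
  rw [coeff_coeff_degreeSeries, PowerSeries.coeff_expand]
  by_cases hb : ∀ j, N ∣ a j
  · obtain ⟨b, rfl⟩ : ∃ b : σ →₀ ℕ, a = N • b := by
      refine ⟨a.mapRange (· / N) (by simp), ?_⟩
      ext j
      simp [Nat.mul_div_cancel' (hb j)]
    rw [MvPowerSeries.coeff_expand_smul]
    by_cases hm : N ∣ m
    · obtain ⟨q, rfl⟩ := hm
      rw [if_pos (dvd_mul_right _ _), Nat.mul_div_cancel_left _ (Nat.pos_of_ne_zero hN),
        PowerSeries.coeff_map]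
      change _ = MvPowerSeries.coeff (N • b) (MvPowerSeries.expand N hN _)
      rw [MvPowerSeries.coeff_expand_smul, coeff_coeff_degreeSeries]
      simp [hN]
    · rw [if_neg hm, if_neg, map_zero]
      rintro rfl
      exact hm (by simp)
  · obtain ⟨j, hj⟩ := not_forall.1 hb
    rw [MvPowerSeries.coeff_expand_of_not_dvd N hN f hj, ite_self]
    split_ifs with hm
    · rw [PowerSeries.coeff_map]
      exact (MvPowerSeries.coeff_expand_of_not_dvd N hN _ hj).symm
    · rw [map_zero]

/-- After the ramification `x ↦ x^{d!}` every monic polynomial of degree `d` splits at each place. -/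
theorem splits_map_placeHom_expand [IsAlgClosed K] [CharZero K]
    {P : Polynomial (MvPowerSeries σ K)} (hP : P.Monic) (i : σ) :
    ((P.map (MvPowerSeries.expand _ P.natDegree.factorial_ne_zero :
      MvPowerSeries σ K →ₐ[K] _).toRingHom).map (placeHom K i)).Splits := by
  set N := P.natDegree.factorial
  have hN : N ≠ 0 := P.natDegree.factorial_ne_zero
  let γ : MvPowerSeries σ K →+* PowerSeries (PlaceField σ K) :=
    (PowerSeries.map ((algebraMap (MvPowerSeries σ K) (PlaceField σ K)).comp
      (MvPowerSeries.expand N hN).toRingHom)).comp (MvPowerSeries.degreeSeries K i)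
  -- Ramifying in `x` and then passing to the place amounts to ramifying in `t`, with `x ↦ x^N`
  -- absorbed in the coefficients; Newton–Puiseux applies to `P.map γ`.
  have hcomp : (placeHom K i).comp (MvPowerSeries.expand N hN).toRingHom =
      (PowerSeries.expandHom (PlaceField σ K) N hN).comp γ := by
    ext f m
    simp only [RingHom.comp_apply, placeHom, γ, PowerSeries.expandHom_apply]
    change PowerSeries.coeff m (PowerSeries.map _
      (MvPowerSeries.degreeSeries K i (MvPowerSeries.expand N hN f))) = _
    rw [MvPowerSeries.degreeSeries_expand, PowerSeries.map_expand, PowerSeries.map_comp]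
    rfl
  have : CharZero (PlaceField σ K) :=
    charZero_of_injective_algebraMap (algebraMap K (PlaceField σ K)).injective
  have h := PowerSeries.splits_map_expand_factorial (hP.map γ)
  rw [Polynomial.map_map, hcomp, ← Polynomial.map_map]
  simpa only [hP.natDegree_map γ] using h

end Places

/-! ### Partial derivatives at the places -/

section PlaceDerivations

/-- The coefficientwise extension of a derivation to formal power series. -/
noncomputable def PowerSeries.mapDerivation {k : Type*} [CommRing k] (D : RingDerivation k k) :
    RingDerivation (PowerSeries k) (PowerSeries k) :=
  RingDerivation.ofLeibniz
    { toFun := fun f => PowerSeries.mk fun m => D (PowerSeries.coeff m f)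
      map_zero' := by ext m; simp
      map_add' := fun f g => by ext m; simp }
    (fun f g => by
      ext m
      simp only [AddMonoidHom.coe_mk, ZeroHom.coe_mk, PowerSeries.coeff_mk, map_add, smul_eq_mul,
        PowerSeries.coeff_mul, map_sum, Derivation.leibniz, Finset.sum_add_distrib]
      congr 1
      rw [← Finset.Nat.sum_antidiagonal_swap]
      rfl)

theorem PowerSeries.coeff_mapDerivation {k : Type*} [CommRing k] (D : RingDerivation k k)
    (f : PowerSeries k) (m : ℕ) :
    PowerSeries.coeff m (PowerSeries.mapDerivation D f) = D (PowerSeries.coeff m f) := by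
  rw [mapDerivation, RingDerivation.ofLeibniz_apply, AddMonoidHom.coe_mk, ZeroHom.coe_mk,
    PowerSeries.coeff_mk]

/-- The partial derivative as a derivation over `ℤ`. -/
noncomputable def MvPowerSeries.ringPderiv {σ : Type*} (K : Type*) [Field K] (l : σ) :
    RingDerivation (MvPowerSeries σ K) (MvPowerSeries σ K) :=
  .ofLeibniz (MvPowerSeries.pderiv K l : MvPowerSeries σ K →ₗ[K] MvPowerSeries σ K).toAddMonoidHom
    fun a b => (MvPowerSeries.pderiv K l).leibniz a b

theorem MvPowerSeries.ringPderiv_apply {σ K : Type*} [Field K] (l : σ) (f : MvPowerSeries σ K) :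
    MvPowerSeries.ringPderiv K l f = MvPowerSeries.pderiv K l f := rfl

/-- The derivation `c · d/dt` of formal power series. -/
noncomputable def PowerSeries.ringDerivative {k : Type*} [CommRing k] (c : k) :
    RingDerivation (PowerSeries k) (PowerSeries k) :=
  .ofLeibniz ((AddMonoidHom.mulLeft (PowerSeries.C c)).comp
    (PowerSeries.derivative k : PowerSeries k →ₗ[k] PowerSeries k).toAddMonoidHom)
    fun a b => by
      change PowerSeries.C c * PowerSeries.derivative k (a * b) =
        a • (PowerSeries.C c * PowerSeries.derivative k b) +
          b • (PowerSeries.C c * PowerSeries.derivative k a)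
      rw [Derivation.leibniz]
      simp only [smul_eq_mul]
      ring

theorem PowerSeries.ringDerivative_apply {k : Type*} [CommRing k] (c : k) (f : PowerSeries k) :
    PowerSeries.ringDerivative c f = PowerSeries.C c * PowerSeries.derivative k f := rfl

variable {σ : Type*} {K : Type*} [Field K] [CharZero K]

/-- For `l = i` the chain rule gives `xᵢ⁻¹ d/dt`. For `l ≠ i` the derivation acts on coefficients,
once extended to the algebraic closure, which is formally étale in characteristic zero. -/
theorem exists_derivation_powerSeries_placeField (i l : σ) :
    ∃ δ : RingDerivation (PowerSeries (PlaceField σ K)) (PowerSeries (PlaceField σ K)),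
      ∀ f, δ (placeHom K i f) = placeHom K i (MvPowerSeries.pderiv K l f) := by
  rcases eq_or_ne l i with rfl | hl
  · have hx : algebraMap (MvPowerSeries σ K) (PlaceField σ K) (MvPowerSeries.X l) ≠ 0 := by
      rw [Ne, map_eq_zero_iff _ algebraMap_placeField_injective]
      exact nonZeroDivisors.ne_zero MvPowerSeries.X_mem_nonzeroDivisors
    refine ⟨PowerSeries.ringDerivative (algebraMap (MvPowerSeries σ K) (PlaceField σ K)
      (MvPowerSeries.X l))⁻¹, fun f => ?_⟩
    ext m
    have h := congrArg (algebraMap (MvPowerSeries σ K) (PlaceField σ K))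
      (MvPowerSeries.X_mul_coeff_degreeSeries_pderiv l f m)
    simp only [map_mul, ← coeff_placeHom, map_add, map_natCast, map_one] at h
    rw [PowerSeries.ringDerivative_apply, PowerSeries.coeff_C_mul, PowerSeries.coeff_derivative,
      ← h, inv_mul_cancel_left₀ hx]
  · let F := FractionRing (MvPowerSeries σ K)
    have hF : Algebra.FormallyEtale (MvPowerSeries σ K) F :=
      Algebra.FormallyEtale.of_isLocalization (nonZeroDivisors (MvPowerSeries σ K))
    have : CharZero F := charZero_of_injective_algebraMap (algebraMap K F).injective
    have hk : Algebra.FormallyEtale F (PlaceField σ K) := Algebra.FormallyEtale.of_isSeparable _ _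
    have hRk : Algebra.FormallyEtale (MvPowerSeries σ K) (PlaceField σ K) :=
      Algebra.FormallyEtale.comp _ F _
    obtain ⟨D, hD⟩ := RingDerivation.exists_extension_of_formallyEtale (B := PlaceField σ K)
      (RingDerivation.comp (Algebra.linearMap (MvPowerSeries σ K) (PlaceField σ K))
        (MvPowerSeries.ringPderiv K l))
    refine ⟨PowerSeries.mapDerivation D, fun f => ?_⟩
    ext m
    rw [PowerSeries.coeff_mapDerivation, coeff_placeHom, coeff_placeHom, hD,
      MvPowerSeries.coeff_degreeSeries_pderiv_of_ne hl]
    rfl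

/-- The extension to the fraction field still preserves `k⟦t⟧`: differentiation creates no poles,
which makes the bounded elements stable. -/
theorem exists_derivation_fractionRing_placeField (i l : σ) :
    ∃ δ : RingDerivation (FractionRing (PowerSeries (PlaceField σ K)))
        (FractionRing (PowerSeries (PlaceField σ K))),
      (∀ v, δ (algebraMap (PowerSeries (PlaceField σ K)) _ v) ∈
        (algebraMap (PowerSeries (PlaceField σ K))
          (FractionRing (PowerSeries (PlaceField σ K)))).range) ∧
      ∀ f, δ (algebraMap (PowerSeries (PlaceField σ K)) _ (placeHom K i f)) =
        algebraMap (PowerSeries (PlaceField σ K)) _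
          (placeHom K i (MvPowerSeries.pderiv K l f)) := by
  obtain ⟨δ, hδ⟩ := exists_derivation_powerSeries_placeField (K := K) i l
  have hF : Algebra.FormallyEtale (PowerSeries (PlaceField σ K))
      (FractionRing (PowerSeries (PlaceField σ K))) :=
    Algebra.FormallyEtale.of_isLocalization (nonZeroDivisors (PowerSeries (PlaceField σ K)))
  obtain ⟨D, hD⟩ := RingDerivation.exists_extension_of_formallyEtale
    (B := FractionRing (PowerSeries (PlaceField σ K)))
    (RingDerivation.comp (Algebra.linearMap (PowerSeries (PlaceField σ K))
      (FractionRing (PowerSeries (PlaceField σ K)))) δ)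
  refine ⟨D, fun v => ⟨δ v, (hD v).symm⟩, fun f => ?_⟩
  rw [hD, ← hδ]
  rfl

end PlaceDerivations

/-! ### Existence of a root and splitting -/

section RootExistence

/-- Both `φ ∘ D` and `δ ∘ φ` are derivations from `B` to `L` that agree on `A`. -/
theorem RingDerivation.map_eq_of_formallyUnramified {A B L : Type*} [CommRing A] [CommRing B]
    [CommRing L] [Algebra A B] [Algebra.FormallyUnramified A B] (φ : B →+* L)
    (D : RingDerivation B B) (δ : RingDerivation L L)
    (h : ∀ a, φ (D (algebraMap A B a)) = δ (φ (algebraMap A B a))) (b : B) :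
    φ (D b) = δ (φ b) := by
  let _ : Algebra B L := φ.toAlgebra
  let _ : Algebra A L := (φ.comp (algebraMap A B)).toAlgebra
  have : IsScalarTower A B L := IsScalarTower.of_algebraMap_eq fun _ => rfl
  let D₁ : RingDerivation B L := RingDerivation.comp (Algebra.linearMap B L) D
  let D₂ : RingDerivation B L :=
    .ofLeibniz ((δ : L →ₗ[ℤ] L).toAddMonoidHom.comp (φ : B →+ L)) fun a b => by
      change δ (φ (a * b)) = φ a * δ (φ b) + φ b * δ (φ a)
      rw [map_mul, Derivation.leibniz]
      rfl
  have : D₁ = D₂ := RingDerivation.ext_of_formallyUnramified (A := A) h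
  exact congrArg (fun d : RingDerivation B L => d b) this

theorem MvPowerSeries.ringPderiv_comm {σ K : Type*} [Field K] (i j : σ) (f : MvPowerSeries σ K) :
    MvPowerSeries.ringPderiv K i (MvPowerSeries.ringPderiv K j f) =
      MvPowerSeries.ringPderiv K j (MvPowerSeries.ringPderiv K i f) := by
  classical
  simp only [MvPowerSeries.ringPderiv_apply]
  ext a
  simp only [MvPowerSeries.coeff_pderiv]
  rcases eq_or_ne i j with rfl | h
  · rfl
  · rw [add_right_comm]
    simp [h, h.symm]
    ring

theorem exists_ringHom_extension_of_isDomain {A C K : Type*} [CommRing A] [CommRing C] [IsDomain A]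
    [IsDomain C] [Algebra A C] [Algebra.IsIntegral A C] [Field K] [IsAlgClosed K]
    (hinj : Function.Injective (algebraMap A C)) (f : A →+* K) (hf : Function.Injective f) :
    ∃ g : C →+* K, g.comp (algebraMap A C) = f := by
  let _ : Algebra A K := f.toAlgebra
  have h1 : FaithfulSMul A K := (faithfulSMul_iff_algebraMap_injective A K).2 hf
  have h2 : FaithfulSMul A C := (faithfulSMul_iff_algebraMap_injective A C).2 hinj
  let g : C →ₐ[A] K := IsAlgClosed.lift
  exact ⟨g.toRingHom, RingHom.ext g.commutes⟩

/-- A ring homomorphism to an algebraically closed field extends along integral extensions. -/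
theorem exists_ringHom_extension_of_isIntegral {R B K : Type*} [CommRing R] [CommRing B]
    [Algebra R B] [Algebra.IsIntegral R B] [Field K] [IsAlgClosed K]
    (hinj : Function.Injective (algebraMap R B)) (χ₀ : R →+* K) :
    ∃ χ : B →+* K, χ.comp (algebraMap R B) = χ₀ := by
  have hp : (RingHom.ker χ₀).IsPrime := RingHom.ker_isPrime χ₀
  obtain ⟨Q, -, hQ, hQp⟩ := Ideal.exists_ideal_over_prime_of_isIntegral (S := B) (RingHom.ker χ₀) ⊥ (by
    rw [← RingHom.ker_eq_comap_bot, (RingHom.injective_iff_ker_eq_bot _).1 hinj]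
    exact bot_le)
  let _ : Algebra (R ⧸ RingHom.ker χ₀) (B ⧸ Q) :=
    (Ideal.quotientMap Q (algebraMap R B) hQp.ge).toAlgebra
  have h3 : Algebra.IsIntegral (R ⧸ RingHom.ker χ₀) (B ⧸ Q) := by
    refine ⟨fun b => ?_⟩
    obtain ⟨b, rfl⟩ := Ideal.Quotient.mk_surjective b
    obtain ⟨p, hp, hpb⟩ := Algebra.IsIntegral.isIntegral (R := R) b
    refine ⟨p.map (Ideal.Quotient.mk _), hp.map _, ?_⟩
    have hc : (algebraMap (R ⧸ RingHom.ker χ₀) (B ⧸ Q)).comp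
        (Ideal.Quotient.mk (RingHom.ker χ₀)) = (Ideal.Quotient.mk Q).comp (algebraMap R B) := rfl
    rw [Polynomial.eval₂_map, hc, ← Polynomial.hom_eval₂, hpb, map_zero]
  obtain ⟨g, hg⟩ := exists_ringHom_extension_of_isDomain
    (A := R ⧸ RingHom.ker χ₀) (C := B ⧸ Q) (Ideal.quotientMap_injective' hQp.le)
    (RingHom.kerLift χ₀) (RingHom.kerLift_injective χ₀)
  refine ⟨g.comp (Ideal.Quotient.mk Q), ?_⟩
  ext r
  exact RingHom.congr_fun hg (Ideal.Quotient.mk _ r)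

/-- The elements of the `R`-algebra `A` which take values in `V` at each of the places
`h i : R → V`. -/
def boundedSubalgebra {ι R V : Type*} [CommRing R] [CommRing V] (h : ι → R →+* V)
    (A : Type*) [CommRing A] [Algebra R A] : Subalgebra R A where
  carrier := {b | ∀ i (φ : A →+* FractionRing V),
    (∀ r, φ (algebraMap R A r) = algebraMap V (FractionRing V) (h i r)) →
      φ b ∈ (algebraMap V (FractionRing V)).range}
  mul_mem' := fun ha hb i φ hφ => by rw [map_mul]; exact mul_mem (ha i φ hφ) (hb i φ hφ)
  add_mem' := fun ha hb i φ hφ => by rw [map_add]; exact add_mem (ha i φ hφ) (hb i φ hφ)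
  algebraMap_mem' := fun r i φ hφ => ⟨h i r, (hφ r).symm⟩

variable {σ : Type*} [Fintype σ] {K : Type*} [Field K] [IsAlgClosed K] [CharZero K]

theorem exists_isRoot_of_splits_placeHom {P : Polynomial (MvPowerSeries σ K)} (hP : P.Monic)
    (hdeg : P.natDegree ≠ 0) {α : σ →₀ ℕ} {p q : Polynomial (MvPowerSeries σ K)}
    (hpq : P.derivative * p + P * q = Polynomial.C (MvPowerSeries.monomial α 1))
    (hs : ∀ i, (P.map (placeHom K i)).Splits) : ∃ ξ, P.IsRoot ξ := by
  classical
  let m : MvPowerSeries σ K := MvPowerSeries.monomial α 1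
  have hm0 : m ≠ 0 := nonZeroDivisors.ne_zero
    (MvPowerSeries.monomial_mem_nonzeroDivisors.2 (one_mem _))
  let E : StandardEtalePair (MvPowerSeries σ K) :=
    ⟨P, hP, Polynomial.C m, p, q, 1, by rw [pow_one]; exact hpq⟩
  have hex : ∀ l : σ, ∃ D : RingDerivation E.Ring E.Ring, ∀ f,
      D (algebraMap _ E.Ring f) = algebraMap _ E.Ring (MvPowerSeries.ringPderiv K l f) := fun l =>
    RingDerivation.exists_extension_of_formallyEtale
      (RingDerivation.comp (Algebra.linearMap _ E.Ring) (MvPowerSeries.ringPderiv K l))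
  choose D hD using hex
  have hcomm : ∀ i j b, D i (D j b) = D j (D i b) := by
    intro i j b
    have h0 : ⁅D i, D j⁆ = (0 : RingDerivation E.Ring E.Ring) := by
      refine RingDerivation.ext_of_formallyUnramified (A := MvPowerSeries σ K) fun f => ?_
      rw [Derivation.commutator_apply, hD, hD, hD, hD, MvPowerSeries.ringPderiv_comm, sub_self]
      rfl
    have := congrArg (fun d : RingDerivation E.Ring E.Ring => d b) h0
    simp only [Derivation.commutator_apply] at this
    exact sub_eq_zero.1 this
  let B := boundedSubalgebra (placeHom (σ := σ) K) E.Ring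
  have hstable : ∀ l, ∀ b ∈ B, D l b ∈ B := by
    intro l b hb i φ hφ
    obtain ⟨δ, hδ₁, hδ₂⟩ := exists_derivation_fractionRing_placeField (K := K) i l
    rw [RingDerivation.map_eq_of_formallyUnramified (A := MvPowerSeries σ K) φ (D l) δ
      (fun f => by rw [hD, hφ, hφ, hδ₂, MvPowerSeries.ringPderiv_apply])]
    obtain ⟨v, hv⟩ := hb i φ hφ
    rw [← hv]
    exact hδ₁ v
  have hint : Algebra.IsIntegral (MvPowerSeries σ K) B := by
    refine ⟨fun b => ?_⟩
    rw [← isIntegral_algHom_iff B.val Subtype.val_injective]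
    refine StandardEtalePair.isIntegral_of_forall_mem_range (placeHom K) E (m := m) rfl
      (fun i h0 => hm0 (placeHom_injective i (by rw [h0, map_zero]))) (fun r f hf => ?_) hs _ b.2
    have : m ^ r = MvPowerSeries.monomial (r • α) 1 := by
      simp [m, MvPowerSeries.monomial_pow]
    rw [this] at hf ⊢
    exact monomial_dvd_of_forall_placeHom_dvd _ _ hf
  -- Any value of `y` is a root of `P` in the fraction field, and `P` already splits over `k⟦t⟧`.
  have hy : E.X ∈ B := by
    intro i φ hφ
    have hroot : ((P.map (placeHom K i)).map (algebraMap (PowerSeries (PlaceField σ K))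
        (FractionRing (PowerSeries (PlaceField σ K))))).IsRoot (φ E.X) := by
      rw [Polynomial.IsRoot, Polynomial.map_map, Polynomial.eval_map,
        show (algebraMap _ _).comp (placeHom K i) = φ.comp (algebraMap _ E.Ring) from
          RingHom.ext fun r => (hφ r).symm, ← Polynomial.hom_eval₂]
      exact (congrArg φ E.hasMap_X.1).trans (map_zero φ)
    rw [← Polynomial.mem_roots (((hP.map _).map _).ne_zero),
      (hs i).roots_map_of_injective (IsFractionRing.injective _ _), Multiset.mem_map] at hroot
    obtain ⟨v, -, hv⟩ := hroot
    exact ⟨v, hv⟩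
  have hinj : Function.Injective (algebraMap (MvPowerSeries σ K) B) := by
    obtain ⟨η, hη⟩ := IsAlgClosed.exists_root
      (P.map (algebraMap (MvPowerSeries σ K) (PlaceField σ K)))
      (by
        rw [hP.degree_map, Polynomial.degree_eq_natDegree hP.ne_zero]
        exact_mod_cast hdeg)
    rw [Polynomial.IsRoot, Polynomial.eval_map] at hη
    have hmap : E.HasMap η := by
      refine ⟨hη, ?_⟩
      rw [Polynomial.aeval_C, isUnit_iff_ne_zero, Ne,
        map_eq_zero_iff _ algebraMap_placeField_injective]
      exact hm0
    have h1 : Function.Injective (algebraMap (MvPowerSeries σ K) E.Ring) := by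
      refine Function.Injective.of_comp (f := E.lift η hmap) ?_
      rw [← AlgHom.coe_toRingHom, ← RingHom.coe_comp, AlgHom.comp_algebraMap]
      exact algebraMap_placeField_injective
    exact fun f g hfg => h1 (congrArg Subtype.val hfg)
  -- For `α ≠ 0` no such extension exists on `E`, where `m` is a unit; this is why the integral
  -- subalgebra `B` is needed.
  obtain ⟨χ, hχ⟩ := exists_ringHom_extension_of_isIntegral hinj
    (MvPowerSeries.constantCoeff (σ := σ) (R := K))
  let D' : σ → RingDerivation B B := fun l => .ofLeibniz
    { toFun := fun b => ⟨D l b, hstable l b b.2⟩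
      map_zero' := Subtype.ext (map_zero _)
      map_add' := fun a b => Subtype.ext (map_add (D l) (a : E.Ring) b) }
    fun a b => Subtype.ext ((D l).leibniz (a : E.Ring) b)
  have hD' : ∀ l b, ((D' l b : B) : E.Ring) = D l b := fun l b => rfl
  have hcomm' : ∀ i j b, D' i (D' j b) = D' j (D' i b) := fun i j b =>
    Subtype.ext (hcomm i j b)
  have hτ := taylorSeriesHom_comp_eq_id D' hcomm' χ (algebraMap (MvPowerSeries σ K) B)
    (fun i f => Subtype.ext (hD i f)) hχ
  set τ := taylorSeriesHom D' hcomm' χ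
  refine ⟨τ ⟨E.X, hy⟩, ?_⟩
  have h0 : Polynomial.aeval (⟨E.X, hy⟩ : B) P = 0 := by
    apply Subtype.val_injective
    change B.val _ = 0
    rw [← Polynomial.aeval_algHom_apply]
    exact E.hasMap_X.1
  have h1 := congrArg τ h0
  rw [Polynomial.aeval_def, Polynomial.hom_eval₂, hτ, map_zero] at h1
  exact h1

theorem splits_of_splits_placeHom {P : Polynomial (MvPowerSeries σ K)} (hP : P.Monic)
    {α : σ →₀ ℕ} {p q : Polynomial (MvPowerSeries σ K)}
    (hpq : P.derivative * p + P * q = Polynomial.C (MvPowerSeries.monomial α 1))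
    (hs : ∀ i, (P.map (placeHom K i)).Splits) : P.Splits := by
  induction hd : P.natDegree generalizing P p q with
  | zero => exact Polynomial.Splits.of_natDegree_eq_zero hd
  | succ d ih =>
    obtain ⟨ξ, hξ⟩ := exists_isRoot_of_splits_placeHom hP (by omega) hpq hs
    obtain ⟨P₁, rfl⟩ := Polynomial.dvd_iff_isRoot.2 hξ
    have hP₁ : P₁.Monic := (Polynomial.monic_X_sub_C ξ).of_mul_monic_left hP
    rw [(Polynomial.monic_X_sub_C ξ).natDegree_mul hP₁, Polynomial.natDegree_X_sub_C] at hd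
    -- Substituting `P' = P₁ + (X - ξ) P₁'` in `hpq` yields the relation for `P₁` with the same
    -- monomial.
    refine (Polynomial.Splits.X_sub_C ξ).mul (ih hP₁ (p := (Polynomial.X - Polynomial.C ξ) * p)
      (q := p + (Polynomial.X - Polynomial.C ξ) * q) ?_ (fun i => ?_) (by omega))
    · rw [← hpq]
      simp only [Polynomial.derivative_mul, Polynomial.derivative_X_sub_C]
      ring
    · exact (hs i).of_dvd ((hP.map _).ne_zero)
        (Polynomial.map_dvd _ (dvd_mul_left _ _))

end RootExistence

/-! ### Fractional exponents -/

section Ramification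

variable {n : ℕ} {K : Type*} [Field K]

/-- The exponent map `a ↦ a / N`. -/
noncomputable def rootExponent (n N : ℕ) : (Fin n →₀ ℕ) →+ (Fin n →₀ ℚ) where
  toFun a := (N : ℚ)⁻¹ • natExponent n a
  map_zero' := by simp
  map_add' a b := by simp

theorem rootExponent_apply (N : ℕ) (a : Fin n →₀ ℕ) (i : Fin n) :
    rootExponent n N a i = (N : ℚ)⁻¹ * (a i : ℚ) := by
  simp [rootExponent, natExponent_apply]

theorem rootExponent_le {N : ℕ} (hN : N ≠ 0) (a b : Fin n →₀ ℕ) :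
    rootExponent n N a ≤ rootExponent n N b ↔ a ≤ b := by
  have hN' : (0 : ℚ) < (N : ℚ)⁻¹ := by positivity
  simp [Finsupp.le_def, rootExponent_apply, hN']

theorem rootExponent_injective {N : ℕ} (hN : N ≠ 0) : Function.Injective (rootExponent n N) :=
  fun a b h => le_antisymm ((rootExponent_le hN a b).1 h.le) ((rootExponent_le hN b a).1 h.ge)

theorem smul_rootExponent {N : ℕ} (hN : N ≠ 0) (a : Fin n →₀ ℕ) :
    N • rootExponent n N a = natExponent n a := by
  have hN' : (N : ℚ) ≠ 0 := Nat.cast_ne_zero.2 hN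
  ext i
  simp [rootExponent_apply, natExponent_apply, hN']

theorem rootExponent_smul {N : ℕ} (hN : N ≠ 0) (a : Fin n →₀ ℕ) :
    rootExponent n N (N • a) = natExponent n a := by
  rw [map_nsmul, smul_rootExponent hN]

/-- The isomorphism `K⟦x⟧ → K⟦x^{1/N}⟧`, `f(x) ↦ f(x^{1/N})`, as a ring homomorphism. -/
noncomputable def rootSubstitution (n : ℕ) (K : Type*) [Field K] {N : ℕ} (hN : N ≠ 0) :
    MvPowerSeries (Fin n) K →+* rootPowerSeries n K N :=
  ((HahnSeries.embDomainRingHom (rootExponent n N) (rootExponent_injective hN)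
    (rootExponent_le hN)).comp
    (HahnSeries.toMvPowerSeries (σ := Fin n) (R := K)).symm.toRingHom).codRestrict _ (by
      intro f a ha
      have h : a ∈ Set.range (rootExponent n N) := by
        by_contra h
        exact ha (HahnSeries.embDomain_of_notMem_range h)
      obtain ⟨b, rfl⟩ := h
      exact ⟨b, smul_rootExponent hN b⟩)

theorem coeff_rootSubstitution {N : ℕ} (hN : N ≠ 0) (f : MvPowerSeries (Fin n) K)
    (a : Fin n →₀ ℕ) :
    (rootSubstitution n K hN f : FracSeries n K).coeff (rootExponent n N a) =
      MvPowerSeries.coeff a f :=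
  HahnSeries.embDomain_coeff
    (f := ⟨⟨rootExponent n N, rootExponent_injective hN⟩, rootExponent_le hN _ _⟩)
    (x := (HahnSeries.toMvPowerSeries (σ := Fin n) (R := K)).symm f)

theorem coeff_rootSubstitution_of_notMem {N : ℕ} (hN : N ≠ 0) (f : MvPowerSeries (Fin n) K)
    {e : Fin n →₀ ℚ} (he : e ∉ Set.range (rootExponent n N)) :
    (rootSubstitution n K hN f : FracSeries n K).coeff e = 0 :=
  HahnSeries.embDomain_of_notMem_range he

theorem coeff_powerSeriesToRoot (N : ℕ) (f : MvPowerSeries (Fin n) K) (a : Fin n →₀ ℕ) :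
    (powerSeriesToRoot n K N f : FracSeries n K).coeff (natExponent n a) =
      MvPowerSeries.coeff a f :=
  HahnSeries.embDomain_coeff
    (f := ⟨⟨natExponent n, natExponent_injective n⟩, natExponent_le _ _⟩)
    (x := (HahnSeries.toMvPowerSeries (σ := Fin n) (R := K)).symm f)

theorem coeff_powerSeriesToRoot_of_notMem (N : ℕ) (f : MvPowerSeries (Fin n) K)
    {e : Fin n →₀ ℚ} (he : e ∉ Set.range (natExponent n)) :
    (powerSeriesToRoot n K N f : FracSeries n K).coeff e = 0 :=
  HahnSeries.embDomain_of_notMem_range he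

/-- Turns a splitting of the ramified polynomial over `K⟦x⟧` into a splitting of `P` over
`K⟦x^{1/N}⟧`. -/
theorem rootSubstitution_comp_expand {N : ℕ} (hN : N ≠ 0) :
    (rootSubstitution n K hN).comp (MvPowerSeries.expand N hN).toRingHom =
      powerSeriesToRoot n K N := by
  ext1 f
  apply Subtype.ext
  ext e
  change (rootSubstitution n K hN (MvPowerSeries.expand N hN f) : FracSeries n K).coeff e = _
  by_cases he : e ∈ Set.range (rootExponent n N)
  · obtain ⟨c, rfl⟩ := he
    rw [coeff_rootSubstitution]
    by_cases hc : ∀ j, N ∣ c j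
    · obtain ⟨b, rfl⟩ : ∃ b : Fin n →₀ ℕ, c = N • b := by
        refine ⟨c.mapRange (· / N) (by simp), ?_⟩
        ext j
        simp [Nat.mul_div_cancel' (hc j)]
      rw [MvPowerSeries.coeff_expand_smul, rootExponent_smul hN, coeff_powerSeriesToRoot]
    · obtain ⟨j, hj⟩ := not_forall.1 hc
      rw [MvPowerSeries.coeff_expand_of_not_dvd N hN f hj, coeff_powerSeriesToRoot_of_notMem]
      rintro ⟨b, hb⟩
      rw [← rootExponent_smul hN] at hb
      exact hj ⟨b j, by rw [← rootExponent_injective hN hb]; simp⟩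
  · rw [coeff_rootSubstitution_of_notMem hN _ he, coeff_powerSeriesToRoot_of_notMem]
    rintro ⟨b, rfl⟩
    exact he ⟨N • b, rootExponent_smul hN b⟩

end Ramification

/-! ### The discriminant and the final theorem -/

/-- The resultant of `P` and `P'` lies in the ideal they generate, and the sign relating it to the
discriminant is absorbed in `p` and `q`. -/
theorem Polynomial.exists_derivative_mul_add_mul_eq_C_discr {R : Type*} [CommRing R]
    {P : Polynomial R} (hP : P.Monic) (hd : P.natDegree ≠ 0) :
    ∃ p q, P.derivative * p + P * q = Polynomial.C P.discr := by
  nontriviality R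
  obtain ⟨q, p, -, -, h⟩ := Polynomial.exists_mul_add_mul_eq_C_resultant P P.derivative
    (m := P.natDegree) (n := P.natDegree - 1) le_rfl (Polynomial.natDegree_derivative_le P)
    (Or.inl hd)
  rw [Polynomial.resultant_deriv (Polynomial.natDegree_pos_iff_degree_pos.1 (Nat.pos_of_ne_zero hd)),
    hP.leadingCoeff, mul_one] at h
  have hsq : ∀ k : ℕ, ((-1 : R) ^ k) * (-1) ^ k = 1 := fun k => by
    rw [← mul_pow]; simp
  refine ⟨Polynomial.C ((-1) ^ (P.natDegree * (P.natDegree - 1) / 2)) * p,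
    Polynomial.C ((-1) ^ (P.natDegree * (P.natDegree - 1) / 2)) * q, ?_⟩
  calc _ = Polynomial.C ((-1) ^ (P.natDegree * (P.natDegree - 1) / 2)) *
        (P * q + P.derivative * p) := by ring
    _ = _ := by rw [h, ← map_mul, ← mul_assoc, hsq, one_mul]

theorem splits_map_expand_of_discr_eq {σ : Type*} [Fintype σ] {K : Type*} [Field K]
    [IsAlgClosed K] [CharZero K] {P : Polynomial (MvPowerSeries σ K)} (hP : P.Monic)
    {α : σ →₀ ℕ} {w : MvPowerSeries σ K} (hw : MvPowerSeries.constantCoeff w ≠ 0)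
    (hdisc : P.discr = MvPowerSeries.monomial α (1 : K) * w) :
    (P.map (MvPowerSeries.expand _ P.natDegree.factorial_ne_zero :
      MvPowerSeries σ K →ₐ[K] _).toRingHom).Splits := by
  by_cases hd : P.natDegree = 0
  · exact Polynomial.Splits.of_natDegree_eq_zero (by rw [hP.natDegree_map, hd])
  set ψ := (MvPowerSeries.expand _ P.natDegree.factorial_ne_zero :
      MvPowerSeries σ K →ₐ[K] MvPowerSeries σ K).toRingHom
  obtain ⟨p, q, hpq⟩ := Polynomial.exists_derivative_mul_add_mul_eq_C_discr hP hd
  have hmul : w * w⁻¹ = 1 := MvPowerSeries.mul_inv_cancel w hw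
  -- The unit part of the discriminant moves into the cofactors, leaving a pure monomial, which the
  -- ramification sends to a monomial.
  have h1 : P.derivative * (p * Polynomial.C w⁻¹) + P * (q * Polynomial.C w⁻¹) =
      Polynomial.C (MvPowerSeries.monomial α 1) := by
    rw [← mul_assoc, ← mul_assoc, ← add_mul, hpq, hdisc, ← map_mul, mul_assoc, hmul, mul_one]
  have h2 := congrArg (Polynomial.map ψ) h1
  rw [Polynomial.map_add, Polynomial.map_mul, ← Polynomial.derivative_map,
    Polynomial.map_mul (p := P), Polynomial.map_C] at h2
  have h3 : ψ (MvPowerSeries.monomial α 1) =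
      MvPowerSeries.monomial (P.natDegree.factorial • α) 1 :=
    MvPowerSeries.expand_monomial _ _ α 1
  rw [h3] at h2
  exact splits_of_splits_placeHom (hP.map ψ) h2 fun i => splits_map_placeHom_expand hP i

theorem Polynomial.Splits.exists_eq_prod_fin {R : Type*} [CommRing R] [IsDomain R]
    {P : Polynomial R} (hs : P.Splits) (hP : P.Monic) :
    ∃ ξ : Fin P.natDegree → R, P = ∏ i, (Polynomial.X - Polynomial.C (ξ i)) := by
  have hlen : P.roots.toList.length = P.natDegree := by
    rw [Multiset.length_toList, hs.natDegree_eq_card_roots]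
  refine ⟨fun i => P.roots.toList[i.1]'(by rw [hlen]; exact i.2), ?_⟩
  have h1 := hs.eq_prod_roots_of_monic hP
  rw [← Multiset.coe_toList P.roots, Multiset.map_coe, Multiset.prod_coe,
    ← Fin.prod_univ_fun_getElem] at h1
  refine h1.trans ?_
  exact Fintype.prod_equiv (finCongr hlen) _ _ fun i => rfl

theorem mainTheorem8 {K : Type*} [Field K] [IsAlgClosed K] [CharZero K] (n d : ℕ)
    (P : Polynomial (MvPowerSeries (Fin n) K)) (hP : P.Monic) (hd : P.natDegree = d)
    (α : Fin n →₀ ℕ) (w : MvPowerSeries (Fin n) K) (hw : MvPowerSeries.constantCoeff w ≠ 0)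
    (hdisc : P.discr = MvPowerSeries.monomial α (1 : K) * w) :
    -- `P` is a product of linear factors over `K⟦x^{1/d!}⟧` ...
    (∃ ξ : Fin d → rootPowerSeries n K d.factorial,
      P.map (powerSeriesToRoot n K d.factorial) =
        ∏ i, (Polynomial.X - Polynomial.C (ξ i))) ∧
    -- ... and every root of `P` in any domain over `K⟦x^{1/d!}⟧`
    -- (such as an algebraic closure of its fraction field) is in `K⟦x^{1/d!}⟧`.
    (∀ (L : Type*) [CommRing L] [IsDomain L] (ι : rootPowerSeries n K d.factorial →+* L) (z : L),
      P.eval₂ (ι.comp (powerSeriesToRoot n K d.factorial)) z = 0 →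
        ∃ ζ : rootPowerSeries n K d.factorial,
          P.eval₂ (powerSeriesToRoot n K d.factorial) ζ = 0 ∧ ι ζ = z) := by
  subst hd
  have hN := P.natDegree.factorial_ne_zero
  have hsplit := splits_map_expand_of_discr_eq hP hw hdisc
  set ψ := (MvPowerSeries.expand _ hN : MvPowerSeries (Fin n) K →ₐ[K] _).toRingHom
  obtain ⟨ξ, hξ⟩ : ∃ ξ : Fin P.natDegree → MvPowerSeries (Fin n) K,
      P.map ψ = ∏ i, (Polynomial.X - Polynomial.C (ξ i)) := by
    have := hsplit.exists_eq_prod_fin (hP.map ψ)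
    rwa [hP.natDegree_map ψ] at this
  have hprod : P.map (powerSeriesToRoot n K P.natDegree.factorial) =
      ∏ i, (Polynomial.X - Polynomial.C (rootSubstitution n K hN (ξ i))) := by
    rw [← rootSubstitution_comp_expand hN, ← Polynomial.map_map, hξ, Polynomial.map_prod]
    simp
  refine ⟨⟨_, hprod⟩, fun L _ _ ι z hz => ?_⟩
  rw [← Polynomial.eval₂_map, hprod, Polynomial.eval₂_finsetProd, Finset.prod_eq_zero_iff] at hz
  obtain ⟨i, -, hi⟩ := hz
  rw [Polynomial.eval₂_sub, Polynomial.eval₂_X, Polynomial.eval₂_C, sub_eq_zero] at hi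
  refine ⟨rootSubstitution n K hN (ξ i), ?_, hi.symm⟩
  rw [Polynomial.eval₂_eq_eval_map, hprod, Polynomial.eval_prod]
  exact Finset.prod_eq_zero (Finset.mem_univ i) (by simp)
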